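/- Let $\mathcal V$ be a real Banach space, and let $\mathcal V\otimes\mathcal V$ be the completion of the algebraic tensor product under a norm satisfying $\|v\otimes w\|\le\|v\|\,\|w\|$. Write $[v,w]=v\otimes w-w\otimes v$ and let $[\mathcal V,\mathcal V]$ be the closed linear span of all $[v,w]$ in $\mathcal V\otimes\mathcal V$. For a function $\alpha$ on $\{0\le s\le t\le1\}$ and $p>0$ put $\|\alpha\|_{p\text{-var}}=\sup_D\big(\sum_j\|\alpha(t_j,t_{j+1})\|^p\big)^{1/p}$, where $D=\{0=t_0<\dots<t_n=1\}$ runs over all finite partitions of $[0,1]$; $\alpha$ is *of vanishing $p$-variation* if the supremum restricted to partitions of mesh at most $\delta$ tends to $0$ as $\delta\to0^+$. For a path $\gamma$ these notions refer to $\alpha(s,t)=\gamma(t)-\gamma(s)$. For a continuous path $\gamma:[0,1]\to\mathcal V$ of bounded variation let $$A(\gamma)(s,t)=\tfrac12\iint_{s<u_1<u_2<t}[d\gamma(u_1),d\gamma(u_2)]=\tfrac12\int_s^t[\gamma(u)-\gamma(s),d\gamma(u)]\qquad(0\le s\le t\le1),$$ a Riemann–Stieltjes integral. Let $\mathcal G_2(\mathcal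 V)$ be the set of continuous paths $\gamma:[0,1]\to\mathcal V$ of vanishing $2$-variation for which there are a continuous $\alpha:\{0\le s\le t\le 1\}\to[\mathcal V,\mathcal V]$ of vanishing $1$-variation with $\alpha(t,t)=0$ for all $t$, and continuous paths $\gamma_n:[0,1]\to\mathcal V$ of bounded variation, such that $$\lim_{n\to\infty}\big(\|\gamma-\gamma_n\|_{2\text{-var}}^2+\|\alpha-A(\gamma_n)\|_{1\text{-var}}\big)^{1/2}=0$$ (that is, $\gamma$ can be enhanced into a geometric $2$-rough path). **(1)** Let $\gamma:[0,1]\to\mathcal V$ be continuous, and suppose that there are a non-decreasing function $m:[0,1]\to[0,\infty)$ with $$\lim_{t\to0^+}m(t)=0,\qquad m(1)\le1,\qquad\int_0^1\frac{m^2(t)}{t}\,dt<\infty,$$ and a constant $C<\infty$ with $\|\gamma(t)-\gamma(s)\|\le C\,|t-s|^{1/2}\,m(t-s)$ for all $0\le s<t\le1$. Then $\gamma\in\mathcal G_2(\mathcal V)$. **(2)** For $0<h\le1$ put $L_0(h)=1/h$ and $L_{n+1}(h)=1+\log L_n(h)$. For an integer $n\ge0$ and $\varepsilon>0$ let $E_{n,\varepsilon}$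 be the linear space of all continuous $\gamma:[0,1]\to\mathcal V$ for which there is a constant $C<\infty$ such that, for all $0\le s<t\le1$ and $h=t-s$, $$\|\gamma(t)-\gamma(s)\|\le C\,\Big(\prod_{i=0}^{n-1}L_i(h)\Big)^{-1/2}L_n(h)^{-1/2-\varepsilon}.$$ (The moduli are $h^{1/2+\varepsilon}$, $h^{1/2}L_1(h)^{-1/2-\varepsilon}$, $h^{1/2}L_1(h)^{-1/2}L_2(h)^{-1/2-\varepsilon}$, and so on.) Then for every $\varepsilon>0$: $E_{n,\varepsilon}\subseteq\mathcal G_2(\mathcal V)$ for every $n\ge0$; $E_{n,\varepsilon}\subseteq E_{n+1,\varepsilon'}$ for all $n\ge0$ and $\varepsilon'>0$, so in particular the spaces $E_{0,\varepsilon}\subseteq E_{1,\varepsilon}\subseteq\cdots$ are nested; and the union $\bigcup_{n\ge0}E_{n,\varepsilon}$ is a linear space contained in $\mathcal G_2(\mathcal V)$. -/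

import Mathlib

open scoped TensorProduct unitInterval Topology ENNReal

noncomputable section

namespace AreaOperator

/-! ### Tensor norms, the Banach spaces `V ⊗ V` and `[V, V]` -/

/-- A norm on the algebraic tensor product `V ⊗ V` such that `‖v ⊗ w‖ ≤ ‖v‖ ‖w‖`. -/
structure TensorNorm (V : Type*) [NormedAddCommGroup V] [NormedSpace ℝ V] where
  toSeminorm : Seminorm ℝ (V ⊗[ℝ] V)
  eq_zero_of_map_eq_zero : ∀ x : V ⊗[ℝ] V, toSeminorm x = 0 → x = 0
  tmul_le : ∀ v w : V, toSeminorm (v ⊗ₜ[ℝ] w) ≤ ‖v‖ * ‖w‖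

section Spaces

variable {V : Type*} [NormedAddCommGroup V] [NormedSpace ℝ V]

/-- The algebraic tensor product `V ⊗ V`, to be normed by `N`. -/
def TensorNorm.Algebraic (_N : TensorNorm V) : Type _ := V ⊗[ℝ] V

instance (N : TensorNorm V) : AddCommGroup N.Algebraic :=
  inferInstanceAs (AddCommGroup (V ⊗[ℝ] V))

instance (N : TensorNorm V) : Module ℝ N.Algebraic :=
  inferInstanceAs (Module ℝ (V ⊗[ℝ] V))

/-- The identity map from `V ⊗ V` to its copy normed by `N`. -/
def TensorNorm.ofTensor (N : TensorNorm V) : V ⊗[ℝ] V ≃ₗ[ℝ] N.Algebraic :=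
  LinearEquiv.refl ℝ (V ⊗[ℝ] V)

/-- `N` as a norm on the additive group `V ⊗ V`. -/
def TensorNorm.groupNorm (N : TensorNorm V) : AddGroupNorm N.Algebraic where
  toFun := fun x => N.toSeminorm x
  map_zero' := map_zero N.toSeminorm
  add_le' := map_add_le_add N.toSeminorm
  neg' := map_neg_eq_map N.toSeminorm
  eq_zero_of_map_eq_zero' := N.eq_zero_of_map_eq_zero

instance (N : TensorNorm V) : NormedAddCommGroup N.Algebraic :=
  N.groupNorm.toNormedAddCommGroup

instance (N : TensorNorm V) : NormedSpace ℝ N.Algebraic where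
  norm_smul_le := fun r x => (map_smul_eq_mul N.toSeminorm r x).le

/-- The Banach space `V ⊗ V`: the completion of the algebraic tensor product. -/
abbrev TensorNorm.Square (N : TensorNorm V) : Type _ := UniformSpace.Completion N.Algebraic

/-- The elementary tensor `v ⊗ w` in the completed tensor product. -/
def TensorNorm.tmul (N : TensorNorm V) (v w : V) : N.Square :=
  (N.ofTensor (v ⊗ₜ[ℝ] w) : UniformSpace.Completion N.Algebraic)

/-- The Banach space `[V, V]`: the closed linear span of all `v ⊗ w - w ⊗ v`. -/
def TensorNorm.bracketSpace (N : TensorNorm V) : Submodule ℝ N.Square :=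
  (Submodule.span ℝ {x | ∃ v w : V, x = N.tmul v w - N.tmul w v}).topologicalClosure

/-- The bracket `[v, w] = v ⊗ w - w ⊗ v`, as an element of `[V, V]`. -/
def TensorNorm.bracket (N : TensorNorm V) (v w : V) : N.bracketSpace :=
  ⟨N.tmul v w - N.tmul w v,
    Submodule.le_topologicalClosure _ (Submodule.subset_span ⟨v, w, rfl⟩)⟩

end Spaces

/-! ### Partitions and `p`-variation on `[0, 1]` -/

/-- `t 0 = a < t 1 < ⋯ < t n = b` is a finite partition of `[a, b]`. -/
def IsPartition (a b : I) (n : ℕ) (t : ℕ → I) : Prop :=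
  t 0 = a ∧ t n = b ∧ ∀ j < n, t j < t (j + 1)

/-- The partition `t 0 < ⋯ < t n` has mesh at most `δ`. -/
def MeshLE (n : ℕ) (t : ℕ → I) (δ : ℝ) : Prop :=
  ∀ j < n, (t (j + 1) : ℝ) - (t j : ℝ) ≤ δ

section Variation

variable {E : Type*} [NormedAddCommGroup E]

/-- The `p`-variation over `[0, 1]` (possibly `∞`) of a function `α (s, t)`, `s ≤ t`. -/
def pVar (p : ℝ) (α : I → I → E) : ℝ≥0∞ :=
  (⨆ (n : ℕ) (t : ℕ → I) (_ : IsPartition 0 1 n t),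
    ∑ j ∈ Finset.range n, ‖α (t j) (t (j + 1))‖ₑ ^ p) ^ (1 / p)

/-- The `p`-variation restricted to the partitions of `[0, 1]` of mesh at most `δ`. -/
def pVarMesh (p : ℝ) (α : I → I → E) (δ : ℝ) : ℝ≥0∞ :=
  (⨆ (n : ℕ) (t : ℕ → I) (_ : IsPartition 0 1 n t) (_ : MeshLE n t δ),
    ∑ j ∈ Finset.range n, ‖α (t j) (t (j + 1))‖ₑ ^ p) ^ (1 / p)

/-- `α` is of vanishing `p`-variation. -/
def VanishingPVar (p : ℝ) (α : I → I → E) : Prop :=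
  Filter.Tendsto (pVarMesh p α) (𝓝[>] 0) (𝓝 0)

/-- The two-parameter function `γ t - γ s` of a path `γ`. -/
def increment (γ : I → E) (s t : I) : E := γ t - γ s

/-- `α` is continuous on the triangle `0 ≤ s ≤ t ≤ 1` and vanishes on the diagonal. Only the values
of `α` on the triangle matter. -/
def IsTriangleFunction (α : I → I → E) : Prop :=
  ContinuousOn (fun z : I × I => α z.1 z.2) {z | z.1 ≤ z.2} ∧ ∀ t, α t t = 0

end Variation

/-! ### Riemann-Stieltjes integrals and the area -/

section Integral

variable {V U E : Type*} [NormedAddCommGroup V] [NormedAddCommGroup U] [NormedAddCommGroup E]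

/-- The Riemann-Stieltjes sums of `∫_s^t B (f u, dg u)`, with arbitrary representative points `ξ`,
converge to `x` as the mesh of the partition tends to `0`. -/
def HasRSIntegral (B : V → U → E) (f : I → V) (g : I → U) (s t : I) (x : E) : Prop :=
  ∀ ε > (0 : ℝ), ∃ δ > (0 : ℝ), ∀ (n : ℕ) (p ξ : ℕ → I), IsPartition s t n p → MeshLE n p δ →
    (∀ j < n, ξ j ∈ Set.Icc (p j) (p (j + 1))) →
    ‖∑ j ∈ Finset.range n, B (f (ξ j)) (g (p (j + 1)) - g (p j)) - x‖ ≤ ε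

open Classical in
/-- The Riemann-Stieltjes integral `∫_s^t B (f u, dg u)` (`0` if it does not exist). -/
def rsIntegral (B : V → U → E) (f : I → V) (g : I → U) (s t : I) : E :=
  if h : ∃ x, HasRSIntegral B f g s t x then h.choose else 0

end Integral

section Paths

variable {V : Type*} [NormedAddCommGroup V] [NormedSpace ℝ V]

/-- The area `A(γ)(s, t) = 1/2 ∬_{s < u₁ < u₂ < t} [dγ(u₁), dγ(u₂)]`. The inner integral, over
`s < u₁ < u₂`, is `γ(u₂) - γ(s)`. -/
def area (N : TensorNorm V) (γ : I → V) (s t : I) : N.bracketSpace :=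
  (1 / 2 : ℝ) • rsIntegral N.bracket (fun u => γ u - γ s) γ s t

/-- The `2`-rough norm `(‖γ‖²_{2-var} + ‖α‖_{1-var})^{1/2}`. -/
def roughNorm (N : TensorNorm V) (γ : I → V) (α : I → I → N.bracketSpace) : ℝ≥0∞ :=
  (pVar 2 (increment γ) ^ (2 : ℝ) + pVar 1 α) ^ (1 / 2 : ℝ)

/-- `(γ, α)` is a geometric `2`-rough path: it is a limit in the `2`-rough norm of
`(γₙ, A(γₙ))` with `γₙ` continuous and of bounded variation. -/
def IsGeometricRoughPath (N : TensorNorm V) (γ : C(I, V)) (α : I → I → N.bracketSpace) : Prop :=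
  IsTriangleFunction α ∧
    ∃ γseq : ℕ → C(I, V), (∀ n, pVar 1 (increment (γseq n)) < ∞) ∧
      Filter.Tendsto
        (fun n => roughNorm N (fun t => γ t - γseq n t) (fun s t => α s t - area N (γseq n) s t))
        Filter.atTop (𝓝 0)

/-- `𝒢₂(V)`: the continuous paths of vanishing `2`-variation that can be enhanced, by some `α` of
vanishing `1`-variation, into a geometric `2`-rough path. -/
def enhancible (N : TensorNorm V) : Set C(I, V) :=
  {γ | VanishingPVar 2 (increment γ) ∧
    ∃ α : I → I → N.bracketSpace, VanishingPVar 1 α ∧ IsGeometricRoughPath N γ α}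

/-! ### Spaces of paths with a given modulus of continuity -/

variable (V) in
/-- The linear space of all continuous paths `γ` such that, for some constant `C`,
`‖γ t - γ s‖ ≤ C w(t - s)` whenever `0 ≤ s < t ≤ 1`. -/
def modulusSpace (w : ℝ → ℝ) : Submodule ℝ C(I, V) where
  carrier := {γ | ∃ C : ℝ, ∀ s t : I, s < t → ‖γ t - γ s‖ ≤ C * w ((t : ℝ) - s)}
  zero_mem' := ⟨0, fun s t _ => by simp⟩
  add_mem' := by
    rintro γ η ⟨C, hC⟩ ⟨D, hD⟩
    refine ⟨C + D, fun s t hst => ?_⟩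
    have h : (γ + η) t - (γ + η) s = (γ t - γ s) + (η t - η s) := by
      simp only [ContinuousMap.add_apply]; abel
    rw [h, add_mul]
    exact (norm_add_le _ _).trans (add_le_add (hC s t hst) (hD s t hst))
  smul_mem' := by
    rintro c γ ⟨C, hC⟩
    refine ⟨‖c‖ * C, fun s t hst => ?_⟩
    have h : (c • γ) t - (c • γ) s = c • (γ t - γ s) := by
      simp only [ContinuousMap.smul_apply, smul_sub]
    rw [h, norm_smul, mul_assoc]
    exact mul_le_mul_of_nonneg_left (hC s t hst) (norm_nonneg c)

end Paths

/-- The iterated logarithms `L₀(h) = 1/h`, `Lₙ₊₁(h) = 1 + log Lₙ(h)`; they are at least `1` for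
`0 < h ≤ 1`. -/
def iterLog : ℕ → ℝ → ℝ
  | 0, h => h⁻¹
  | n + 1, h => 1 + Real.log (iterLog n h)

/-- The modulus `(L₀ ⋯ Lₙ₋₁)^{-1/2} Lₙ^{-1/2-ε}`: this is `h^{1/2+ε}` for `n = 0`,
`h^{1/2} L₁^{-1/2-ε}` for `n = 1`, `h^{1/2} L₁^{-1/2} L₂^{-1/2-ε}` for `n = 2`, and so on. -/
def logModulus (n : ℕ) (ε : ℝ) (h : ℝ) : ℝ :=
  (∏ i ∈ Finset.range n, iterLog i h ^ (-(1 / 2) : ℝ)) * iterLog n h ^ (-(1 / 2) - ε)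

end AreaOperator

end

/-!
Extend `γ` to a continuous `f : ℝ → V`, constant outside `[0, 1]`, and write `ω(h) = C √h m(h)` for
its modulus. The approximating paths are the Steklov means `xₙ(u) = δ⁻¹ ∫_0^δ f (u + v) dv` at scale
`δ = 2⁻ⁿ`. They are continuously differentiable, inherit the modulus `ω`, stay within `ω(δ)` of `f`
and have speed at most `ω(δ) / δ`. Hence the squared increments of `f - xₙ` over `[s, t]` are at most
`4 C² m(δ)² (t - s)` (`HasRootModulus.norm_sub_steklov_sq_le`), which gives convergence in
`2`-variation.

For the areas, put `x = xₙ`, `y = xₙ₊₁`, `η = x - y`, and let a subscript denote an increment.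
Integrating by parts (`norm_smoothArea_sub_le`),
`2 (A(x) - A(y))(s, t) = [y_st, η_st] + ∫_s^t [η_su, x' u + y' u] du`, so that `η` is never
differentiated. The integral is `O(m(δ)² (t - s))`, as `η = O(ω(δ))` and the speeds are
`O(ω(δ) / δ)`. The boundary term is of the same size if `h = t - s ≤ δ`; otherwise it is
`O(ω(h) ω(δ)) = O(h m(δ)² + δ m(h)²)`. At the dyadic scale `2⁻ᵏ` of `h` the second summand is
`O(h 2^{-(n - k)} m(2⁻ᵏ)²)`, a term of the convolution `dyadicWeight` of the samples `m(2⁻ᵏ)²` with a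
geometric sequence. By the integral test `∫ m² / t dt < ∞` makes the samples summable
(`summable_sq_half_pow`), hence the convolution too. Therefore `A(xₙ)(s, t)` converges to some
`α(s, t)` at a rate `rₙ (t - s)` with `rₙ → 0`. Summed over a partition of `[0, 1]` this bounds the
`1`-variation of `α - A(xₙ)` by `rₙ`. As `A(xₙ)(s, t) = O((t - s)²)` for each fixed `n`, it also
shows that `α` has vanishing `1`-variation (`HasRootModulus.mem_enhancible`).

For the logarithmic moduli with `n ≥ 1`, the function `m² / t` has the primitive `Lₙ^{-2ε} / (2ε)`,
which is continuous up to `0` (`integrableOn_logGauge_sq_div`). The inclusions between consecutive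
spaces follow from `(1 + log x)^a = O(x^b)` on `[1, ∞)`, and they reduce the case `n = 0` to `n = 1`.
-/

namespace AreaOperator

open Filter MeasureTheory

/-! ### The bracket as a continuous bilinear map -/

section Bracket

variable {V : Type*} [NormedAddCommGroup V] [NormedSpace ℝ V]

theorem TensorNorm.tmul_add_left (N : TensorNorm V) (v v' w : V) :
    N.tmul (v + v') w = N.tmul v w + N.tmul v' w := by
  simp only [TensorNorm.tmul, TensorProduct.add_tmul, map_add, UniformSpace.Completion.coe_add]

theorem TensorNorm.tmul_add_right (N : TensorNorm V) (v w w' : V) :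
    N.tmul v (w + w') = N.tmul v w + N.tmul v w' := by
  simp only [TensorNorm.tmul, TensorProduct.tmul_add, map_add, UniformSpace.Completion.coe_add]

theorem TensorNorm.tmul_smul_left (N : TensorNorm V) (c : ℝ) (v w : V) :
    N.tmul (c • v) w = c • N.tmul v w := by
  simp only [TensorNorm.tmul, ← TensorProduct.smul_tmul', map_smul,
    UniformSpace.Completion.coe_smul]

theorem TensorNorm.tmul_smul_right (N : TensorNorm V) (c : ℝ) (v w : V) :
    N.tmul v (c • w) = c • N.tmul v w := by
  simp only [TensorNorm.tmul, TensorProduct.tmul_smul, map_smul, UniformSpace.Completion.coe_smul]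

theorem TensorNorm.norm_tmul_le (N : TensorNorm V) (v w : V) : ‖N.tmul v w‖ ≤ ‖v‖ * ‖w‖ := by
  rw [TensorNorm.tmul, UniformSpace.Completion.norm_coe]
  exact N.tmul_le v w

theorem TensorNorm.norm_bracket_le (N : TensorNorm V) (v w : V) :
    ‖N.bracket v w‖ ≤ 2 * ‖v‖ * ‖w‖ := by
  have h : ‖N.bracket v w‖ = ‖N.tmul v w - N.tmul w v‖ := rfl
  rw [h]
  have h1 := norm_sub_le (N.tmul v w) (N.tmul w v)
  have h2 := N.norm_tmul_le v w
  have h3 := N.norm_tmul_le w v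
  nlinarith

/-- The bracket as a continuous bilinear map. -/
noncomputable def TensorNorm.bracketCLM (N : TensorNorm V) : V →L[ℝ] V →L[ℝ] N.bracketSpace :=
  (LinearMap.mk₂ ℝ N.bracket
    (fun v v' w => Subtype.ext (by
      simp only [TensorNorm.bracket, Submodule.coe_add, N.tmul_add_left, N.tmul_add_right]; abel))
    (fun c v w => Subtype.ext (by
      simp only [TensorNorm.bracket, Submodule.coe_smul, N.tmul_smul_left, N.tmul_smul_right,
        smul_sub]))
    (fun v w w' => Subtype.ext (by
      simp only [TensorNorm.bracket, Submodule.coe_add, N.tmul_add_left, N.tmul_add_right]; abel))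
    (fun c v w => Subtype.ext (by
      simp only [TensorNorm.bracket, Submodule.coe_smul, N.tmul_smul_left, N.tmul_smul_right,
        smul_sub]))).mkContinuous₂ 2 (fun v w => N.norm_bracket_le v w)

theorem TensorNorm.bracketCLM_apply (N : TensorNorm V) (v w : V) :
    N.bracketCLM v w = N.bracket v w := rfl

theorem TensorNorm.norm_bracketCLM_le (N : TensorNorm V) (v w : V) :
    ‖N.bracketCLM v w‖ ≤ 2 * ‖v‖ * ‖w‖ := N.norm_bracket_le v w

theorem TensorNorm.bracketCLM_swap (N : TensorNorm V) (v w : V) :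
    N.bracketCLM v w = -N.bracketCLM w v :=
  Subtype.ext (by simp [TensorNorm.bracketCLM_apply, TensorNorm.bracket])

instance (N : TensorNorm V) : CompleteSpace N.bracketSpace :=
  (Submodule.isClosed_topologicalClosure _).completeSpace_coe

end Bracket

/-! ### Variation of functions bounded by the length of the interval -/

section Variation

variable {E : Type*} [NormedAddCommGroup E]

theorem IsPartition.sum_sub {a b : I} {n : ℕ} {t : ℕ → I} (h : IsPartition a b n t) :
    ∑ j ∈ Finset.range n, ((t (j + 1) : ℝ) - t j) = b - a := by
  rw [Finset.sum_range_sub (fun j => (t j : ℝ)), h.1, h.2.1]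

theorem IsPartition.sum_enorm_rpow_le {p K : ℝ} (hp : 0 < p) {α : I → I → E} {n : ℕ}
    {t : ℕ → I} (ht : IsPartition 0 1 n t)
    (h : ∀ j < n, ‖α (t j) (t (j + 1))‖ ^ p ≤ K * ((t (j + 1) : ℝ) - t j)) :
    ∑ j ∈ Finset.range n, ‖α (t j) (t (j + 1))‖ₑ ^ p ≤ ENNReal.ofReal K := by
  have h1 : ∀ j ∈ Finset.range n, ‖α (t j) (t (j + 1))‖ₑ ^ p
      = ENNReal.ofReal (‖α (t j) (t (j + 1))‖ ^ p) := fun j _ => by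
    rw [← ENNReal.ofReal_rpow_of_nonneg (norm_nonneg _) hp.le, ofReal_norm]
  rw [Finset.sum_congr rfl h1, ← ENNReal.ofReal_sum_of_nonneg (fun j _ => by positivity)]
  refine ENNReal.ofReal_le_ofReal ?_
  calc _ ≤ ∑ j ∈ Finset.range n, K * ((t (j + 1) : ℝ) - t j) :=
        Finset.sum_le_sum fun j hj => h j (Finset.mem_range.1 hj)
    _ = K := by rw [← Finset.mul_sum, ht.sum_sub]; simp

theorem pVar_le {p K : ℝ} (hp : 0 < p) {α : I → I → E}
    (h : ∀ s t : I, s < t → ‖α s t‖ ^ p ≤ K * ((t : ℝ) - s)) :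
    pVar p α ≤ ENNReal.ofReal K ^ (1 / p) := by
  refine ENNReal.rpow_le_rpow ?_ (by positivity)
  exact iSup_le fun n => iSup_le fun t => iSup_le fun ht =>
    ht.sum_enorm_rpow_le hp fun j hj => h _ _ (ht.2.2 j hj)

theorem pVarMesh_le {p K δ : ℝ} (hp : 0 < p) {α : I → I → E}
    (h : ∀ s t : I, s < t → (t : ℝ) - s ≤ δ → ‖α s t‖ ^ p ≤ K * ((t : ℝ) - s)) :
    pVarMesh p α δ ≤ ENNReal.ofReal K ^ (1 / p) := by
  refine ENNReal.rpow_le_rpow ?_ (by positivity)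
  exact iSup_le fun n => iSup_le fun t => iSup_le fun ht => iSup_le fun hδ =>
    ht.sum_enorm_rpow_le hp fun j hj => h _ _ (ht.2.2 j hj) (hδ j hj)

/-- A function with `‖α (s, t)‖ ^ p = o(t - s)`, uniformly, has vanishing `p`-variation. -/
theorem vanishingPVar_of_isLittleO {p : ℝ} (hp : 0 < p) {α : I → I → E}
    (h : ∀ ε > (0 : ℝ), ∃ δ > (0 : ℝ), ∀ s t : I, s < t → (t : ℝ) - s ≤ δ →
      ‖α s t‖ ^ p ≤ ε * ((t : ℝ) - s)) : VanishingPVar p α := by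
  rw [VanishingPVar, ENNReal.tendsto_nhds_zero]
  intro η hη
  have hcont : Tendsto (fun ε : ℝ => ENNReal.ofReal ε ^ (1 / p)) (𝓝[>] 0) (𝓝 0) := by
    have h1 : Continuous fun ε : ℝ => ENNReal.ofReal ε ^ (1 / p) :=
      ENNReal.continuous_rpow_const.comp ENNReal.continuous_ofReal
    have h2 := h1.tendsto 0
    rw [ENNReal.ofReal_zero, ENNReal.zero_rpow_of_pos (by positivity)] at h2
    exact h2.mono_left nhdsWithin_le_nhds
  obtain ⟨ε, hεη, hε⟩ :=
    ((ENNReal.tendsto_nhds_zero.1 hcont η hη).and self_mem_nhdsWithin).exists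
  obtain ⟨δ, hδ, H⟩ := h ε hε
  filter_upwards [Ioc_mem_nhdsGT hδ] with d hd
  exact (pVarMesh_le hp fun s t hst hd' => H s t hst (hd'.trans hd.2)).trans hεη

end Variation

/-! ### Riemann-Stieltjes integrals against continuously differentiable paths -/

section Integral

theorem exists_isPartition_meshLE {s t : I} (hst : s ≤ t) {δ : ℝ} (hδ : 0 < δ) :
    ∃ (n : ℕ) (p : ℕ → I), IsPartition s t n p ∧ MeshLE n p δ := by
  rcases hst.eq_or_lt with rfl | hlt
  · exact ⟨0, fun _ => s, ⟨rfl, rfl, by simp⟩, by simp [MeshLE]⟩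
  have hlt' : (0 : ℝ) < (t : ℝ) - s := sub_pos.2 hlt
  obtain ⟨n, hn⟩ := exists_nat_gt (((t : ℝ) - s) / δ)
  have hn0 : (0 : ℝ) < n := (div_pos hlt' hδ).trans hn
  set h : ℝ := ((t : ℝ) - s) / n with hh
  have hh0 : 0 < h := div_pos hlt' hn0
  have hnh : n * h = (t : ℝ) - s := by rw [hh]; field_simp
  have hmem : ∀ j : ℕ, j ≤ n → (s : ℝ) + j * h ∈ Set.Icc (0 : ℝ) 1 := fun j hj => by
    have : (j : ℝ) * h ≤ n * h := by gcongr
    refine ⟨add_nonneg s.2.1 (by positivity), ?_⟩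
    linarith [t.2.2]
  have hval : ∀ j : ℕ, j ≤ n →
      ((Set.projIcc (0 : ℝ) 1 zero_le_one (s + j * h) : I) : ℝ) = s + j * h := fun j hj => by
    rw [Set.projIcc_of_mem _ (hmem j hj)]
  refine ⟨n, fun j => Set.projIcc (0 : ℝ) 1 zero_le_one (s + j * h), ⟨?_, ?_, ?_⟩, ?_⟩
  · exact Subtype.ext (by rw [hval 0 (Nat.zero_le n)]; simp)
  · exact Subtype.ext (by rw [hval n le_rfl]; linarith)
  · intro j hj
    rw [← Subtype.coe_lt_coe, hval j hj.le, hval (j + 1) hj]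
    push_cast
    linarith
  · intro j hj
    rw [hval j hj.le, hval (j + 1) hj]
    have : h ≤ δ := by
      rw [hh, div_le_iff₀ hn0]
      rw [div_lt_iff₀ hδ] at hn
      linarith
    push_cast
    linarith

variable {V U E : Type*} [NormedAddCommGroup U] [NormedAddCommGroup E]

theorem HasRSIntegral.unique {B : V → U → E} {f : I → V} {g : I → U} {s t : I} (hst : s ≤ t)
    {x y : E} (hx : HasRSIntegral B f g s t x) (hy : HasRSIntegral B f g s t y) : x = y := by
  rw [← sub_eq_zero, ← norm_le_zero_iff]
  refine le_of_forall_pos_le_add fun ε hε => ?_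
  obtain ⟨δ, hδ, h1⟩ := hx (ε / 2) (half_pos hε)
  obtain ⟨δ', hδ', h2⟩ := hy (ε / 2) (half_pos hε)
  obtain ⟨n, p, hp, hm⟩ := exists_isPartition_meshLE hst (lt_min hδ hδ')
  have hξ : ∀ j < n, p j ∈ Set.Icc (p j) (p (j + 1)) := fun j hj => ⟨le_rfl, (hp.2.2 j hj).le⟩
  have e1 := h1 n p p hp (fun j hj => (hm j hj).trans (min_le_left _ _)) hξ
  have e2 := h2 n p p hp (fun j hj => (hm j hj).trans (min_le_right _ _)) hξ
  set S := ∑ j ∈ Finset.range n, B (f (p j)) (g (p (j + 1)) - g (p j))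
  calc ‖x - y‖ = ‖(S - y) - (S - x)‖ := by congr 1; abel
    _ ≤ ‖S - y‖ + ‖S - x‖ := norm_sub_le _ _
    _ ≤ 0 + ε := by linarith

theorem HasRSIntegral.rsIntegral_eq {B : V → U → E} {f : I → V} {g : I → U} {s t : I}
    (hst : s ≤ t) {x : E} (hx : HasRSIntegral B f g s t x) : rsIntegral B f g s t = x := by
  have h : ∃ x, HasRSIntegral B f g s t x := ⟨x, hx⟩
  rw [rsIntegral, dif_pos h]
  exact HasRSIntegral.unique hst h.choose_spec hx

variable [NormedAddCommGroup V] [NormedSpace ℝ V] [NormedSpace ℝ U] [NormedSpace ℝ E]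
  [CompleteSpace U] [CompleteSpace E]

theorem hasRSIntegral_of_hasDerivAt (B : V →L[ℝ] U →L[ℝ] E) {f : ℝ → V} {g g' : ℝ → U}
    (hf : Continuous f) (hg : ∀ u, HasDerivAt g (g' u) u) (hg' : Continuous g') (s t : I) :
    HasRSIntegral (fun v w => B v w) (fun u : I => f u) (fun u : I => g u) s t
      (∫ u in (s : ℝ)..t, B (f u) (g' u)) := by
  intro ε hε
  obtain ⟨G, hG⟩ := isCompact_Icc.exists_bound_of_continuousOn (s := Set.Icc (0 : ℝ) 1)
    hg'.continuousOn
  have hG0 : 0 ≤ G := (norm_nonneg _).trans (hG 0 ⟨le_rfl, zero_le_one⟩)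
  -- `c` is the oscillation of `f` that keeps the error below `ε`
  set c : ℝ := ε / ((‖B‖ + 1) * (G + 1)) with hc
  have hc0 : 0 < c := by positivity
  have huc : UniformContinuousOn f (Set.Icc (0 : ℝ) 1) :=
    isCompact_Icc.uniformContinuousOn_of_continuous hf.continuousOn
  obtain ⟨δ, hδ, H⟩ := Metric.uniformContinuousOn_iff_le.1 huc c hc0
  refine ⟨δ, hδ, fun n p ξ hp hm hξ => ?_⟩
  have hint : ∀ a b : ℝ, IntervalIntegrable (fun u => B (f u) (g' u)) volume a b := fun a b =>
    ((B.continuous.comp hf).clm_apply hg').intervalIntegrable a b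
  have hsum := intervalIntegral.sum_integral_adjacent_intervals (μ := volume)
    (f := fun u => B (f u) (g' u)) (a := fun j => (p j : ℝ)) (n := n) (fun _ _ => hint _ _)
  simp only [hp.1, hp.2.1] at hsum
  rw [← hsum, ← Finset.sum_sub_distrib]
  have hterm : ∀ j ∈ Finset.range n,
      ‖B (f (ξ j)) (g (p (j + 1)) - g (p j)) - ∫ u in (p j : ℝ)..p (j + 1), B (f u) (g' u)‖
        ≤ ε * ((p (j + 1) : ℝ) - p j) := by
    intro j hj
    have hj := Finset.mem_range.1 hj
    have hlt : (p j : ℝ) < p (j + 1) := hp.2.2 j hj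
    have hFTC : ∫ u in (p j : ℝ)..p (j + 1), g' u = g (p (j + 1)) - g (p j) :=
      intervalIntegral.integral_eq_sub_of_hasDerivAt (fun u _ => hg u)
        (hg'.intervalIntegrable _ _)
    rw [← hFTC, ← ContinuousLinearMap.intervalIntegral_comp_comm _ (hg'.intervalIntegrable _ _),
      ← intervalIntegral.integral_sub
        (Continuous.intervalIntegrable (by fun_prop) _ _) (hint _ _),
      ← abs_of_pos (sub_pos.2 hlt)]
    refine intervalIntegral.norm_integral_le_of_norm_le_const fun u hu => ?_
    rw [Set.uIoc_of_le hlt.le] at hu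
    have hu01 : u ∈ Set.Icc (0 : ℝ) 1 := ⟨(p j).2.1.trans hu.1.le, hu.2.trans (p (j + 1)).2.2⟩
    have hξj : (p j : ℝ) ≤ ξ j ∧ (ξ j : ℝ) ≤ p (j + 1) := hξ j hj
    have hosc : ‖f (ξ j) - f u‖ ≤ c := by
      rw [← dist_eq_norm]
      refine H _ (ξ j).2 _ hu01 ?_
      rw [Real.dist_eq, abs_le]
      have := hm j hj
      constructor <;> linarith [hu.1, hu.2, hξj.1, hξj.2]
    rw [← sub_apply, ← map_sub]
    calc ‖B (f (ξ j) - f u) (g' u)‖ ≤ ‖B‖ * ‖f (ξ j) - f u‖ * ‖g' u‖ := B.le_opNorm₂ _ _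
      _ ≤ (‖B‖ + 1) * c * (G + 1) := by
          have := hG u hu01
          gcongr <;> linarith
      _ = ε := by rw [hc]; field_simp
  calc _ ≤ ∑ j ∈ Finset.range n, ε * ((p (j + 1) : ℝ) - p j) := norm_sum_le_of_le _ hterm
    _ = ε * ((t : ℝ) - s) := by rw [← Finset.mul_sum, hp.sum_sub]
    _ ≤ ε * 1 := by gcongr; linarith [t.2.2, s.2.1]
    _ = ε := mul_one ε

end Integral

/-! ### The area of a continuously differentiable path -/

section SmoothArea

variable {V : Type*} [NormedAddCommGroup V] [NormedSpace ℝ V]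

/-- The area `1/2 ∫_s^t [x u - x s, x' u] du` of a path `x` with derivative `x'`. -/
noncomputable def smoothArea (N : TensorNorm V) (x x' : ℝ → V) (s t : ℝ) : N.bracketSpace :=
  (1 / 2 : ℝ) • ∫ u in s..t, N.bracketCLM (x u - x s) (x' u)

theorem area_eq_smoothArea [CompleteSpace V] (N : TensorNorm V) {x x' : ℝ → V}
    (hx : ∀ u, HasDerivAt x (x' u) u) (hx' : Continuous x') {s t : I} (hst : s ≤ t) :
    area N (fun u : I => x u) s t = smoothArea N x x' s t := by
  have hc : Continuous x := continuous_iff_continuousAt.2 fun u => (hx u).continuousAt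
  have h := hasRSIntegral_of_hasDerivAt N.bracketCLM (f := fun u => x u - x s) (g := x) (g' := x')
    (by fun_prop) hx hx' s t
  rw [area, smoothArea]
  congr 1
  exact HasRSIntegral.rsIntegral_eq hst h

theorem continuous_smoothArea (N : TensorNorm V) {x x' : ℝ → V} (hx : Continuous x)
    (hx' : Continuous x') : Continuous fun z : ℝ × ℝ => smoothArea N x x' z.1 z.2 := by
  have hF : Continuous (Function.uncurry fun (z : ℝ × ℝ) (u : ℝ) =>
      N.bracketCLM (x u - x z.1) (x' u)) := by
    unfold Function.uncurry
    fun_prop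
  have h : (fun z : ℝ × ℝ => smoothArea N x x' z.1 z.2) = fun z => (1 / 2 : ℝ) •
      ((∫ u in (0 : ℝ)..z.2, N.bracketCLM (x u - x z.1) (x' u)) -
        ∫ u in (0 : ℝ)..z.1, N.bracketCLM (x u - x z.1) (x' u)) := by
    funext z
    have hz : Continuous fun u => N.bracketCLM (x u - x z.1) (x' u) := by fun_prop
    rw [smoothArea, intervalIntegral.integral_interval_sub_left (hz.intervalIntegrable _ _)
      (hz.intervalIntegrable _ _)]
  rw [h]
  have hI : ∀ {r : ℝ × ℝ → ℝ}, Continuous r → Continuous fun z : ℝ × ℝ =>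
      ∫ u in (0 : ℝ)..r z, N.bracketCLM (x u - x z.1) (x' u) := fun hr =>
    intervalIntegral.continuous_parametric_intervalIntegral_of_continuous (μ := volume) hF hr
  exact ((hI continuous_snd).sub (hI continuous_fst)).const_smul (1 / 2 : ℝ)

/-- The area of a path of speed at most `X` is quadratically small in `t - s`. -/
theorem norm_smoothArea_le (N : TensorNorm V) {x x' : ℝ → V} (hx : ∀ u, HasDerivAt x (x' u) u)
    {X : ℝ} (hX : ∀ u, ‖x' u‖ ≤ X) {s t : ℝ} (hst : s ≤ t) :
    ‖smoothArea N x x' s t‖ ≤ X ^ 2 * (t - s) * (t - s) := by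
  have hX0 : 0 ≤ X := (norm_nonneg _).trans (hX 0)
  have h : ‖∫ u in s..t, N.bracketCLM (x u - x s) (x' u)‖ ≤ 2 * (X * (t - s)) * X * |t - s| := by
    refine intervalIntegral.norm_integral_le_of_norm_le_const fun u hu => ?_
    rw [Set.uIoc_of_le hst] at hu
    have h1 : ‖x u - x s‖ ≤ X * ‖u - s‖ :=
      Convex.norm_image_sub_le_of_norm_hasDerivWithin_le (s := Set.univ)
        (fun v _ => (hx v).hasDerivWithinAt) (fun v _ => hX v) convex_univ trivial trivial
    have h2 : ‖u - s‖ ≤ t - s := by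
      rw [Real.norm_of_nonneg (by linarith [hu.1])]; linarith [hu.2]
    have h3 : ‖x u - x s‖ ≤ X * (t - s) := h1.trans (by gcongr)
    refine (N.norm_bracketCLM_le _ _).trans ?_
    have := hX u
    have h0 : 0 ≤ X * (t - s) := (norm_nonneg _).trans h3
    gcongr
  rw [smoothArea, norm_smul, Real.norm_of_nonneg (by norm_num)]
  rw [abs_of_nonneg (by linarith)] at h
  linarith

/-- Integration by parts turns the difference of the areas of `x` and `y` into a boundary term and
an integral in which `x - y` is not differentiated:
`2 (A(x) - A(y))(s, t) = [y_st, η_st] + ∫_s^t [η_su, x' u + y' u] du` with `η = x - y`. -/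
theorem norm_smoothArea_sub_le (N : TensorNorm V) {x x' y y' : ℝ → V}
    (hx : ∀ u, HasDerivAt x (x' u) u) (hx' : Continuous x')
    (hy : ∀ u, HasDerivAt y (y' u) u) (hy' : Continuous y') {X Y H s t : ℝ} (hst : s ≤ t)
    (hX : ∀ u, ‖x' u‖ ≤ X) (hY : ∀ u, ‖y' u‖ ≤ Y)
    (hH : ∀ u, ‖(x u - y u) - (x s - y s)‖ ≤ H) :
    ‖smoothArea N x x' s t - smoothArea N y y' s t‖ ≤
      ‖y t - y s‖ * ‖(x t - y t) - (x s - y s)‖ + H * (X + Y) * (t - s) := by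
  have hxc : Continuous x := continuous_iff_continuousAt.2 fun u => (hx u).continuousAt
  have hyc : Continuous y := continuous_iff_continuousAt.2 fun u => (hy u).continuousAt
  set B := N.bracketCLM with hB
  set η : ℝ → V := fun u => (x u - y u) - (x s - y s) with hη
  have hηd : ∀ u, HasDerivAt η (x' u - y' u) u := fun u => ((hx u).sub (hy u)).sub_const _
  have hysd : ∀ u, HasDerivAt (fun u => y u - y s) (y' u) u := fun u => (hy u).sub_const _
  have hηc : Continuous η := by fun_prop
  have hparts : ∫ u in s..t, (B (y u - y s) (x' u - y' u) + B (y' u) (η u))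
      = B (y t - y s) (η t) := by
    rw [intervalIntegral.integral_eq_sub_of_hasDerivAt (f := fun u => B (y u - y s) (η u))
      (fun u _ => B.hasDerivAt_of_bilinear (fun _ => hysd u) (fun _ => hηd u))
      (Continuous.intervalIntegrable (by fun_prop) _ _)]
    simp
  have hkey : (∫ u in s..t, B (x u - x s) (x' u)) - ∫ u in s..t, B (y u - y s) (y' u)
      = B (y t - y s) (η t) + ∫ u in s..t, B (η u) (x' u + y' u) := by
    rw [← hparts, ← intervalIntegral.integral_sub (Continuous.intervalIntegrable (by fun_prop) _ _)
      (Continuous.intervalIntegrable (by fun_prop) _ _),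
      ← intervalIntegral.integral_add (Continuous.intervalIntegrable (by fun_prop) _ _)
      (Continuous.intervalIntegrable (by fun_prop) _ _)]
    refine intervalIntegral.integral_congr fun u _ => ?_
    have h1 : x u - x s = η u + (y u - y s) := by simp only [hη]; abel
    have h2 : B (y' u) (η u) = -B (η u) (y' u) := N.bracketCLM_swap _ _
    simp only [h1, h2, map_add, map_sub, add_apply]
    abel
  have hI : ‖∫ u in s..t, B (η u) (x' u + y' u)‖ ≤ 2 * H * (X + Y) * |t - s| := by
    refine intervalIntegral.norm_integral_le_of_norm_le_const fun u _ => ?_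
    refine (N.norm_bracketCLM_le _ _).trans ?_
    have h1 := hH u
    have h2 := norm_add_le_of_le (hX u) (hY u)
    have h0 : 0 ≤ H := (norm_nonneg _).trans h1
    gcongr
  have hb : ‖B (y t - y s) (η t)‖ ≤ 2 * ‖y t - y s‖ * ‖η t‖ := N.norm_bracketCLM_le _ _
  rw [smoothArea, smoothArea, ← smul_sub, hkey, norm_smul, Real.norm_of_nonneg (by norm_num)]
  have hn := norm_add_le (B (y t - y s) (η t)) (∫ u in s..t, B (η u) (x' u + y' u))
  rw [abs_of_nonneg (by linarith)] at hI
  linarith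

end SmoothArea

/-! ### Steklov means -/

section Steklov

variable {V : Type*} [NormedAddCommGroup V] [NormedSpace ℝ V]

/-- The Steklov mean `u ↦ δ⁻¹ ∫_0^δ f (u + v) dv`. -/
noncomputable def steklov (f : ℝ → V) (δ u : ℝ) : V := δ⁻¹ • ∫ v in (0 : ℝ)..δ, f (u + v)

/-- The derivative `δ⁻¹ (f (u + δ) - f u)` of the Steklov mean. -/
noncomputable def steklovDeriv (f : ℝ → V) (δ u : ℝ) : V := δ⁻¹ • (f (u + δ) - f u)

variable {f : ℝ → V}

theorem hasDerivAt_steklov [CompleteSpace V] (hf : Continuous f) (δ u : ℝ) :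
    HasDerivAt (steklov f δ) (steklovDeriv f δ u) u := by
  have hF : ∀ w, HasDerivAt (fun w => ∫ v in (0 : ℝ)..w, f v) (f w) w := fun w =>
    (hf.integral_hasStrictDerivAt 0 w).hasDerivAt
  have h : steklov f δ = fun u => δ⁻¹ • ((∫ v in (0 : ℝ)..u + δ, f v) - ∫ v in (0 : ℝ)..u, f v) := by
    funext u
    rw [steklov, intervalIntegral.integral_comp_add_left, add_zero,
      intervalIntegral.integral_interval_sub_left (hf.intervalIntegrable _ _)
        (hf.intervalIntegrable _ _)]
  rw [h]
  exact (((hF (u + δ)).comp_add_const u δ).sub (hF u)).const_smul _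

theorem continuous_steklovDeriv (hf : Continuous f) (δ : ℝ) : Continuous (steklovDeriv f δ) := by
  unfold steklovDeriv
  fun_prop

theorem norm_steklov_sub_le (hf : Continuous f) {δ : ℝ} (hδ : 0 < δ) {s t K : ℝ}
    (h : ∀ v, ‖f (t + v) - f (s + v)‖ ≤ K) : ‖steklov f δ t - steklov f δ s‖ ≤ K := by
  rw [steklov, steklov, ← smul_sub, ← intervalIntegral.integral_sub
    (Continuous.intervalIntegrable (by fun_prop) _ _)
    (Continuous.intervalIntegrable (by fun_prop) _ _), norm_smul, norm_inv,
    Real.norm_of_nonneg hδ.le, inv_mul_le_iff₀ hδ]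
  have := intervalIntegral.norm_integral_le_of_norm_le_const (a := 0) (b := δ)
    (f := fun v => f (t + v) - f (s + v)) (fun v _ => h v)
  rwa [sub_zero, abs_of_pos hδ, mul_comm] at this

theorem norm_steklov_sub_self_le [CompleteSpace V] (hf : Continuous f) {δ : ℝ} (hδ : 0 < δ)
    {u K : ℝ} (h : ∀ v ∈ Set.Ioc 0 δ, ‖f (u + v) - f u‖ ≤ K) : ‖steklov f δ u - f u‖ ≤ K := by
  have hc : f u = δ⁻¹ • ∫ _ in (0 : ℝ)..δ, f u := by
    rw [intervalIntegral.integral_const, sub_zero, inv_smul_smul₀ hδ.ne']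
  rw [steklov, hc, ← smul_sub, ← intervalIntegral.integral_sub
    (Continuous.intervalIntegrable (by fun_prop) _ _)
    (Continuous.intervalIntegrable (by fun_prop) _ _), norm_smul, norm_inv,
    Real.norm_of_nonneg hδ.le, inv_mul_le_iff₀ hδ]
  have := intervalIntegral.norm_integral_le_of_norm_le_const (a := 0) (b := δ)
    (f := fun v => f (u + v) - f u) (fun v hv => h v (by rwa [Set.uIoc_of_le hδ.le] at hv))
  rwa [sub_zero, abs_of_pos hδ, mul_comm] at this

theorem norm_steklovDeriv_le {δ : ℝ} (hδ : 0 < δ) {u K : ℝ} (h : ‖f (u + δ) - f u‖ ≤ K) :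
    ‖steklovDeriv f δ u‖ ≤ K / δ := by
  rw [steklovDeriv, norm_smul, norm_inv, Real.norm_of_nonneg hδ.le, div_eq_inv_mul]
  gcongr

end Steklov

/-! ### Summability of dyadic samples -/

section Dyadic

/-- The integral test for `∫ m² / t dt` along the sequence `2⁻ᵏ`. -/
theorem summable_sq_half_pow {m : ℝ → ℝ} (hm0 : ∀ t ∈ Set.Icc (0 : ℝ) 1, 0 ≤ m t)
    (hmono : MonotoneOn m (Set.Icc 0 1))
    (hint : IntegrableOn (fun t => m t ^ 2 / t) (Set.Ioc 0 1)) :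
    Summable fun k : ℕ => m ((1 / 2) ^ k) ^ 2 := by
  set q : ℕ → ℝ := fun k => (1 / 2) ^ k with hq
  have hq0 : ∀ k, 0 < q k := fun k => by positivity
  have hq1 : ∀ k, q k ≤ 1 := fun k => pow_le_one₀ (by norm_num) (by norm_num)
  have hqs : ∀ k, q (k + 1) = q k / 2 := fun k => by simp only [hq, pow_succ]; ring
  have hii : ∀ a b : ℝ, 0 < a → a ≤ 1 → 0 < b → b ≤ 1 →
      IntervalIntegrable (fun t => m t ^ 2 / t) volume a b := fun a b ha ha1 hb hb1 => by
    rw [intervalIntegrable_iff]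
    exact hint.mono_set fun t ht => ⟨(lt_min ha hb).trans ht.1, ht.2.trans (max_le ha1 hb1)⟩
  have hnn : ∀ t ∈ Set.Ioc (0 : ℝ) 1, 0 ≤ m t ^ 2 / t := fun t ht =>
    div_nonneg (sq_nonneg _) ht.1.le
  have hstep : ∀ k, m (q (k + 1)) ^ 2 ≤ -2 * ∫ t in q k..q (k + 1), m t ^ 2 / t := by
    intro k
    have hle : q (k + 1) ≤ q k := by rw [hqs]; linarith [hq0 k]
    have h := intervalIntegral.integral_mono_on (μ := volume)
      (f := fun _ => m (q (k + 1)) ^ 2 / q k) (g := fun t => m t ^ 2 / t) hle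
      (by simp) (hii _ _ (hq0 _) (hq1 _) (hq0 _) (hq1 _)) (fun t ht => by
        have ht0 : 0 < t := (hq0 _).trans_le ht.1
        have h1 : m (q (k + 1)) ≤ m t :=
          hmono ⟨(hq0 _).le, hq1 _⟩ ⟨ht0.le, ht.2.trans (hq1 k)⟩ ht.1
        have h2 := hm0 (q (k + 1)) ⟨(hq0 _).le, hq1 _⟩
        have h3 := ht.2
        gcongr)
    rw [intervalIntegral.integral_const, smul_eq_mul, hqs] at h
    rw [intervalIntegral.integral_symm, hqs]
    have h4 : (q k - q k / 2) * (m (q k / 2) ^ 2 / q k) = m (q k / 2) ^ 2 / 2 := by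
      have := (hq0 k).ne'
      field_simp
      ring
    rw [h4] at h
    linarith
  rw [← summable_nat_add_iff 1]
  refine summable_of_sum_range_le (c := 2 * ∫ t in Set.Ioc (0 : ℝ) 1, m t ^ 2 / t)
    (fun _ => sq_nonneg _) fun n => ?_
  refine (Finset.sum_le_sum fun k _ => hstep k).trans ?_
  rw [← Finset.mul_sum, intervalIntegral.sum_integral_adjacent_intervals
    (fun k _ => hii _ _ (hq0 _) (hq1 _) (hq0 _) (hq1 _)), intervalIntegral.integral_symm,
    intervalIntegral.integral_of_le (by simpa [hq] using hq1 n)]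
  have := setIntegral_mono_set (μ := volume) (s := Set.Ioc (q n) (q 0)) hint
    ((ae_restrict_iff' measurableSet_Ioc).2 (Eventually.of_forall hnn))
    (Set.Ioc_subset_Ioc (hq0 n).le (hq1 0)).eventuallyLE
  linarith

/-- The convolution of the samples `m (2⁻ᵏ)²` with the geometric sequence `2⁻ᵏ`. -/
noncomputable def dyadicWeight (m : ℝ → ℝ) (n : ℕ) : ℝ :=
  ∑ k ∈ Finset.range (n + 1), m ((1 / 2) ^ k) ^ 2 * (1 / 2) ^ (n - k)

theorem dyadicWeight_nonneg (m : ℝ → ℝ) (n : ℕ) : 0 ≤ dyadicWeight m n :=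
  Finset.sum_nonneg fun k _ => by positivity

theorem summable_dyadicWeight {m : ℝ → ℝ} (h : Summable fun k : ℕ => m ((1 / 2) ^ k) ^ 2) :
    Summable (dyadicWeight m) := by
  have hg : Summable fun k : ℕ => (1 / 2 : ℝ) ^ k := summable_geometric_two
  exact (summable_norm_sum_mul_range_of_summable_norm h.norm hg.norm).of_norm

theorem sq_mul_le_dyadicWeight (m : ℝ → ℝ) {k n : ℕ} (hk : k ≤ n) :
    m ((1 / 2) ^ k) ^ 2 * (1 / 2) ^ (n - k) ≤ dyadicWeight m n :=
  Finset.single_le_sum (f := fun k => m ((1 / 2) ^ k) ^ 2 * (1 / 2) ^ (n - k))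
    (fun k _ => by positivity) (Finset.mem_range.2 (Nat.lt_succ_of_le hk))

theorem half_pow_mul_sq_le {m : ℝ → ℝ} (hm0 : ∀ t ∈ Set.Icc (0 : ℝ) 1, 0 ≤ m t)
    (hmono : MonotoneOn m (Set.Icc 0 1)) {n : ℕ} {h : ℝ} (hn : (1 / 2) ^ n < h) (h1 : h ≤ 1) :
    (1 / 2) ^ n * m h ^ 2 ≤ 2 * dyadicWeight m n * h := by
  have h0 : 0 < h := lt_trans (by positivity) hn
  -- the dyadic scale of `h`, which is coarser than `2⁻ⁿ`
  obtain ⟨k, hk1, hk2⟩ := exists_nat_pow_near_of_lt_one h0 h1 (y := (1 / 2 : ℝ)) (by norm_num)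
    (by norm_num)
  have hkn : k ≤ n := by
    by_contra! hlt
    exact absurd (hn.trans_le (hk2.trans
      (pow_le_pow_of_le_one (by norm_num) (by norm_num) hlt.le))) (lt_irrefl _)
  have hmh : m h ≤ m ((1 / 2) ^ k) :=
    hmono ⟨h0.le, h1⟩ ⟨by positivity, pow_le_one₀ (by norm_num) (by norm_num)⟩ hk2
  have hmh0 := hm0 h ⟨h0.le, h1⟩
  have hsplit : (1 / 2 : ℝ) ^ n = (1 / 2) ^ (n - k) * (1 / 2) ^ k := by
    rw [← pow_add, Nat.sub_add_cancel hkn]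
  have hkh : (1 / 2 : ℝ) ^ k ≤ 2 * h := by rw [pow_succ] at hk1; linarith
  calc (1 / 2) ^ n * m h ^ 2 ≤ (1 / 2) ^ (n - k) * (2 * h) * m ((1 / 2) ^ k) ^ 2 := by
        rw [hsplit]; gcongr
    _ = m ((1 / 2) ^ k) ^ 2 * (1 / 2) ^ (n - k) * (2 * h) := by ring
    _ ≤ dyadicWeight m n * (2 * h) := by
        gcongr
        exact sq_mul_le_dyadicWeight m hkn
    _ = _ := by ring

end Dyadic

/-! ### Approximation of a path with modulus `h^{1/2} m(h)` by its Steklov means -/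

section Modulus

variable {V : Type*} [NormedAddCommGroup V]

/-- `f : ℝ → V` is continuous and `‖f t - f s‖ ≤ C √h m(h)` for `0 < h = t - s ≤ 1`, where `m` is
nonnegative and nondecreasing on `[0, 1]`. -/
structure HasRootModulus (f : ℝ → V) (C : ℝ) (m : ℝ → ℝ) : Prop where
  continuous : Continuous f
  const_nonneg : 0 ≤ C
  nonneg : ∀ t ∈ Set.Icc (0 : ℝ) 1, 0 ≤ m t
  mono : MonotoneOn m (Set.Icc 0 1)
  increment_le : ∀ s t : ℝ, s < t → t - s ≤ 1 → ‖f t - f s‖ ≤ C * (√(t - s) * m (t - s))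

theorem hasRootModulus_IccExtend {γ : C(I, V)} {m : ℝ → ℝ}
    (hm0 : ∀ t ∈ Set.Icc (0 : ℝ) 1, 0 ≤ m t) (hmono : MonotoneOn m (Set.Icc 0 1)) {C : ℝ}
    (hC : ∀ s t : I, s < t → ‖γ t - γ s‖ ≤ C * (((t : ℝ) - s) ^ (1 / 2 : ℝ) * m ((t : ℝ) - s))) :
    HasRootModulus (Set.IccExtend zero_le_one γ) |C| m := by
  refine ⟨γ.continuous.Icc_extend', abs_nonneg C, hm0, hmono, fun s t hst h1 => ?_⟩
  simp only [Set.IccExtend, Function.comp_apply]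
  set a : I := Set.projIcc (0 : ℝ) 1 zero_le_one s
  set b : I := Set.projIcc (0 : ℝ) 1 zero_le_one t
  have hab : a ≤ b := Set.monotone_projIcc _ hst.le
  have hlen : (b : ℝ) - a ≤ t - s := by
    have := Set.abs_projIcc_sub_projIcc (c := t) (d := s) (zero_le_one (α := ℝ))
    rw [abs_of_pos (sub_pos.2 hst)] at this
    exact (le_abs_self _).trans this
  have hpos : 0 < t - s := sub_pos.2 hst
  have hmt := hm0 _ ⟨hpos.le, h1⟩
  rcases hab.eq_or_lt with h | h
  · rw [h, sub_self, norm_zero]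
    positivity
  · have hba : (0 : ℝ) < b - a := sub_pos.2 h
    have h2 := hC a b h
    have h3 := hm0 _ ⟨hba.le, hlen.trans h1⟩
    have h4 := hmono ⟨hba.le, hlen.trans h1⟩ ⟨hpos.le, h1⟩ hlen
    rw [← Real.sqrt_eq_rpow] at h2
    have h5 := le_abs_self C
    calc _ ≤ _ := h2
      _ ≤ |C| * (√(t - s) * m (t - s)) := by gcongr

namespace HasRootModulus

variable {f : ℝ → V} {C : ℝ} {m : ℝ → ℝ}

theorem modulus_mono (hf : HasRootModulus f C m) {a b : ℝ} (ha : 0 ≤ a) (hab : a ≤ b)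
    (hb : b ≤ 1) : C * (√a * m a) ≤ C * (√b * m b) := by
  have h1 := hf.mono ⟨ha, hab.trans hb⟩ ⟨ha.trans hab, hb⟩ hab
  have h2 := hf.nonneg a ⟨ha, hab.trans hb⟩
  have h3 := hf.const_nonneg
  gcongr

theorem modulus_nonneg (hf : HasRootModulus f C m) {a : ℝ} (ha : 0 ≤ a) (ha1 : a ≤ 1) :
    0 ≤ C * (√a * m a) :=
  mul_nonneg hf.const_nonneg (mul_nonneg (Real.sqrt_nonneg _) (hf.nonneg a ⟨ha, ha1⟩))

variable [NormedSpace ℝ V]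

theorem norm_steklov_sub_le (hf : HasRootModulus f C m) {δ : ℝ} (hδ : 0 < δ) {s t : ℝ}
    (hst : s < t) (h1 : t - s ≤ 1) :
    ‖steklov f δ t - steklov f δ s‖ ≤ C * (√(t - s) * m (t - s)) := by
  refine AreaOperator.norm_steklov_sub_le hf.continuous hδ fun v => ?_
  have := hf.increment_le (s + v) (t + v) (by linarith) (by linarith)
  rwa [add_sub_add_right_eq_sub] at this

theorem norm_steklovDeriv_le (hf : HasRootModulus f C m) {δ : ℝ} (hδ : 0 < δ) (hδ1 : δ ≤ 1)
    (u : ℝ) : ‖steklovDeriv f δ u‖ ≤ C * (√δ * m δ) / δ := by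
  refine AreaOperator.norm_steklovDeriv_le hδ ?_
  have := hf.increment_le u (u + δ) (by linarith) (by linarith)
  rwa [add_sub_cancel_left] at this

variable [CompleteSpace V]

theorem norm_steklov_sub_self_le (hf : HasRootModulus f C m) {δ : ℝ} (hδ : 0 < δ) (hδ1 : δ ≤ 1)
    (u : ℝ) : ‖steklov f δ u - f u‖ ≤ C * (√δ * m δ) := by
  refine AreaOperator.norm_steklov_sub_self_le hf.continuous hδ fun v hv => ?_
  have := hf.increment_le u (u + v) (by linarith [hv.1]) (by linarith [hv.2])
  rw [add_sub_cancel_left] at this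
  exact this.trans (hf.modulus_mono hv.1.le hv.2 hδ1)

/-- Increments of the error are controlled by the modulus over intervals shorter than `δ`, and by
the uniform distance of the paths over longer ones. -/
theorem norm_sub_steklov_sq_le (hf : HasRootModulus f C m) {δ : ℝ} (hδ : 0 < δ) (hδ1 : δ ≤ 1)
    {s t : ℝ} (hst : s < t) (h1 : t - s ≤ 1) :
    ‖(f t - steklov f δ t) - (f s - steklov f δ s)‖ ^ 2 ≤ 4 * C ^ 2 * m δ ^ 2 * (t - s) := by
  have hh : 0 < t - s := sub_pos.2 hst
  have key : ‖(f t - steklov f δ t) - (f s - steklov f δ s)‖ ≤ 2 * (C * (√(t - s) * m δ)) := by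
    have hmδ := hf.nonneg δ ⟨hδ.le, hδ1⟩
    have hC := hf.const_nonneg
    rcases le_total (t - s) δ with h | h
    · have e1 := hf.increment_le s t hst h1
      have e2 := hf.norm_steklov_sub_le hδ hst h1
      have e3 : C * (√(t - s) * m (t - s)) ≤ C * (√(t - s) * m δ) := by
        have := hf.mono ⟨hh.le, h1⟩ ⟨hδ.le, hδ1⟩ h
        gcongr
      calc _ = ‖(f t - f s) - (steklov f δ t - steklov f δ s)‖ := by congr 1; abel
        _ ≤ _ := norm_sub_le _ _
        _ ≤ _ := by linarith
    · have e1 := hf.norm_steklov_sub_self_le hδ hδ1 s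
      have e2 := hf.norm_steklov_sub_self_le hδ hδ1 t
      have e3 : C * (√δ * m δ) ≤ C * (√(t - s) * m δ) := by gcongr
      rw [norm_sub_rev] at e1 e2
      exact (norm_sub_le _ _).trans (by linarith)
  calc _ ≤ (2 * (C * (√(t - s) * m δ))) ^ 2 := by gcongr
    _ = 4 * C ^ 2 * m δ ^ 2 * √(t - s) ^ 2 := by ring
    _ = _ := by rw [Real.sq_sqrt hh.le]

/-- Halving the scale of the Steklov mean changes the area by `O(ρ (t - s))`, where `ρ` dominates
both `m(δ)²` and, at scales `h = t - s` coarser than `δ`, the boundary contribution `m(h)² δ / h`. -/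
theorem norm_smoothArea_steklov_sub_le (N : TensorNorm V) (hf : HasRootModulus f C m) {δ ρ : ℝ}
    (hδ : 0 < δ) (hδ1 : δ ≤ 1) {s t : ℝ} (hst : s < t) (h1 : t - s ≤ 1) (hρ : m δ ^ 2 ≤ ρ)
    (hρ' : δ < t - s → δ * m (t - s) ^ 2 ≤ ρ * (t - s)) :
    ‖smoothArea N (steklov f δ) (steklovDeriv f δ) s t -
      smoothArea N (steklov f (δ / 2)) (steklovDeriv f (δ / 2)) s t‖ ≤
      16 * C ^ 2 * ρ * (t - s) := by
  have hδ2 : 0 < δ / 2 := half_pos hδ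
  have hδ21 : δ / 2 ≤ 1 := by linarith
  set h := t - s with hh_def
  have hh : 0 < h := sub_pos.2 hst
  set x := steklov f δ
  set y := steklov f (δ / 2)
  set Ω := C * (√δ * m δ) with hΩ
  set ω := C * (√h * m h) with hω
  have hΩ0 : 0 ≤ Ω := hf.modulus_nonneg hδ.le hδ1
  have hω0 : 0 ≤ ω := hf.modulus_nonneg hh.le h1
  have hΩsq : Ω ^ 2 = C ^ 2 * m δ ^ 2 * δ := by
    rw [hΩ, mul_pow, mul_pow, Real.sq_sqrt hδ.le]; ring
  have hωsq : ω ^ 2 = C ^ 2 * m h ^ 2 * h := by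
    rw [hω, mul_pow, mul_pow, Real.sq_sqrt hh.le]; ring
  have hmono : C * (√(δ / 2) * m (δ / 2)) ≤ Ω := hf.modulus_mono hδ2.le (by linarith) hδ1
  have hclose : ∀ u, ‖x u - y u‖ ≤ 2 * Ω := fun u => by
    have e1 := hf.norm_steklov_sub_self_le hδ hδ1 u
    have e2 := hf.norm_steklov_sub_self_le hδ2 hδ21 u
    calc ‖x u - y u‖ = ‖(x u - f u) - (y u - f u)‖ := by congr 1; abel
      _ ≤ _ := norm_sub_le _ _
      _ ≤ _ := by linarith
  have hη : ∀ u, ‖(x u - y u) - (x s - y s)‖ ≤ 4 * Ω := fun u =>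
    (norm_sub_le _ _).trans (by linarith [hclose u, hclose s])
  have hY : ∀ u, ‖steklovDeriv f (δ / 2) u‖ ≤ 2 * (Ω / δ) := fun u => by
    refine (hf.norm_steklovDeriv_le hδ2 hδ21 u).trans ?_
    rw [div_le_iff₀ hδ2]
    have : 2 * (Ω / δ) * (δ / 2) = Ω := by field_simp
    rwa [this]
  have hmain := norm_smoothArea_sub_le N (fun u => hasDerivAt_steklov hf.continuous δ u)
    (continuous_steklovDeriv hf.continuous δ)
    (fun u => hasDerivAt_steklov hf.continuous (δ / 2) u)
    (continuous_steklovDeriv hf.continuous (δ / 2)) hst.le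
    (hf.norm_steklovDeriv_le hδ hδ1) hY hη
  have hC2 : 0 ≤ C ^ 2 := sq_nonneg C
  have hint : 4 * Ω * (Ω / δ + 2 * (Ω / δ)) * h ≤ 12 * C ^ 2 * ρ * h := by
    have : 4 * Ω * (Ω / δ + 2 * (Ω / δ)) * h = 12 * (Ω ^ 2 / δ) * h := by ring
    rw [this, hΩsq, mul_div_cancel_right₀ _ hδ.ne', ← mul_assoc]
    gcongr
  have hyst : ‖y t - y s‖ ≤ ω := hf.norm_steklov_sub_le hδ2 hst h1
  have hbdry : ‖y t - y s‖ * ‖(x t - y t) - (x s - y s)‖ ≤ 4 * C ^ 2 * ρ * h := by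
    rcases le_or_gt h δ with hle | hlt
    · have hxst : ‖x t - x s‖ ≤ ω := hf.norm_steklov_sub_le hδ hst h1
      have hηst : ‖(x t - y t) - (x s - y s)‖ ≤ 2 * ω := by
        calc _ = ‖(x t - x s) - (y t - y s)‖ := by congr 1; abel
          _ ≤ _ := norm_sub_le _ _
          _ ≤ _ := by linarith
      have hm : m h ^ 2 ≤ ρ := by
        have e1 := hf.mono ⟨hh.le, h1⟩ ⟨hδ.le, hδ1⟩ hle
        have e2 := hf.nonneg h ⟨hh.le, h1⟩
        exact le_trans (by gcongr) hρ
      calc _ ≤ ω * (2 * ω) := by gcongr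
        _ = 2 * (C ^ 2 * m h ^ 2 * h) := by rw [← hωsq]; ring
        _ ≤ 4 * (C ^ 2 * ρ * h) := by
          have e : C ^ 2 * m h ^ 2 * h ≤ C ^ 2 * ρ * h := by gcongr
          have e0 : 0 ≤ C ^ 2 * m h ^ 2 * h := by positivity
          linarith
        _ = _ := by ring
    · -- AM-GM, after exchanging the factors `m δ` and `m h`
      have e1 : m δ ^ 2 * h ≤ ρ * h := by gcongr
      have e2 := hρ' hlt
      have hprod : ω * (4 * Ω) ≤ 2 * C ^ 2 * (m δ ^ 2 * h + δ * m h ^ 2) := by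
        have e3 : ω * (4 * Ω) = 2 * C ^ 2 * (2 * (√h * m δ) * (√δ * m h)) := by
          rw [hω, hΩ]; ring
        have e4 := two_mul_le_add_sq (√h * m δ) (√δ * m h)
        rw [mul_pow, mul_pow, Real.sq_sqrt hh.le, Real.sq_sqrt hδ.le] at e4
        rw [e3]
        gcongr
        linarith
      calc _ ≤ ω * (4 * Ω) := by gcongr; exact hη t
        _ ≤ _ := hprod
        _ ≤ 2 * C ^ 2 * (ρ * h + ρ * h) := by gcongr
        _ = _ := by ring
  linarith

end HasRootModulus

end Modulus

/-! ### The enhanced path -/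

section Enhancement

/-- Telescoping: the limit exists at every point of `S`, and the error after `n` steps is the `n`-th
tail of `∑ d`, scaled by `ℓ`. -/
theorem exists_limit_of_norm_sub_le {ι F : Type*} [NormedAddCommGroup F]
    [CompleteSpace F] {A : ℕ → ι → F} {d : ℕ → ℝ} (hd : Summable d) {ℓ : ι → ℝ} {S : Set ι}
    (h : ∀ n, ∀ z ∈ S, ‖A n z - A (n + 1) z‖ ≤ d n * ℓ z) :
    ∃ α : ι → F, ∀ n, ∀ z ∈ S, ‖α z - A n z‖ ≤ (∑' k, d (k + n)) * ℓ z := by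
  have hlim : ∀ z, ∃ a, z ∈ S → ∀ n, ‖a - A n z‖ ≤ (∑' k, d (k + n)) * ℓ z := by
    intro z
    by_cases hz : z ∈ S
    · have h' : ∀ n, dist (A n z) (A n.succ z) ≤ d n * ℓ z := fun n => by
        rw [dist_eq_norm]; exact h n z hz
      have hs : Summable fun n => d n * ℓ z := hd.mul_right _
      obtain ⟨a, ha⟩ := cauchySeq_tendsto_of_complete (cauchySeq_of_dist_le_of_summable _ h' hs)
      refine ⟨a, fun _ n => ?_⟩
      have := dist_le_tsum_of_dist_le_of_tendsto _ h' hs ha n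
      rwa [dist_comm, dist_eq_norm, tsum_mul_right, tsum_congr fun k => by rw [add_comm n k]]
        at this
    · exact ⟨0, fun hz' => absurd hz' hz⟩
  choose α hα using hlim
  exact ⟨α, fun n z hz => hα z hz n⟩

variable {V : Type*} [NormedAddCommGroup V] [NormedSpace ℝ V] [CompleteSpace V]

/-- The Steklov mean at scale `2⁻ⁿ`, restricted to `[0, 1]`. -/
noncomputable def steklovPath (f : ℝ → V) (hf : Continuous f) (n : ℕ) : C(I, V) where
  toFun u := steklov f ((1 / 2) ^ n) u
  continuous_toFun :=
    (continuous_iff_continuousAt.2 fun u => (hasDerivAt_steklov hf ((1 / 2) ^ n) u).continuousAt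
      : Continuous (steklov f ((1 / 2) ^ n))).comp continuous_subtype_val

/-- A path whose modulus has square summable dyadic samples can be enhanced: the areas of its
Steklov means converge at the rate `t - s` times the tail of a convergent series. -/
theorem HasRootModulus.mem_enhancible (N : TensorNorm V) {f : ℝ → V} {C : ℝ} {m : ℝ → ℝ}
    (hf : HasRootModulus f C m) (hm : Tendsto m (𝓝[>] 0) (𝓝 0))
    (hsum : Summable fun k : ℕ => m ((1 / 2) ^ k) ^ 2) {γ : C(I, V)} (hγ : ∀ u : I, γ u = f u) :
    γ ∈ enhancible N := by
  have hq0 : ∀ n : ℕ, (0 : ℝ) < (1 / 2) ^ n := fun n => by positivity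
  have hq1 : ∀ n : ℕ, (1 / 2 : ℝ) ^ n ≤ 1 := fun n => pow_le_one₀ (by norm_num) (by norm_num)
  have hlen : ∀ s t : I, (t : ℝ) - s ≤ 1 := fun s t => by linarith [t.2.2, s.2.1]
  have hlt : ∀ s t : I, s < t → (s : ℝ) < t := fun s t h => h
  set x : ℕ → ℝ → V := fun n => steklov f ((1 / 2) ^ n) with hx_def
  set x' : ℕ → ℝ → V := fun n => steklovDeriv f ((1 / 2) ^ n) with hx'_def
  have hx : ∀ n u, HasDerivAt (x n) (x' n u) u := fun n u =>
    hasDerivAt_steklov hf.continuous _ u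
  have hxc : ∀ n, Continuous (x n) := fun n =>
    continuous_iff_continuousAt.2 fun u => (hx n u).continuousAt
  have hx' : ∀ n, Continuous (x' n) := fun n => continuous_steklovDeriv hf.continuous _
  have hspeed : ∀ n, ∃ X, ∀ u, ‖x' n u‖ ≤ X := fun n =>
    ⟨_, hf.norm_steklovDeriv_le (hq0 n) (hq1 n)⟩
  set A : ℕ → I × I → N.bracketSpace := fun n z => smoothArea N (x n) (x' n) z.1 z.2 with hA
  set d : ℕ → ℝ := fun n => 16 * C ^ 2 * (2 * dyadicWeight m n) with hd_def
  have hd : Summable d := ((summable_dyadicWeight hsum).mul_left 2).mul_left _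
  have hstep : ∀ n, ∀ z ∈ {z : I × I | z.1 ≤ z.2},
      ‖A n z - A (n + 1) z‖ ≤ d n * ((z.2 : ℝ) - z.1) := by
    rintro n ⟨s, t⟩ hst
    rcases (show s ≤ t from hst).eq_or_lt with rfl | hst
    · simp [hA, smoothArea]
    · have hw : m ((1 / 2) ^ n) ^ 2 ≤ 2 * dyadicWeight m n := by
        have h1 := sq_mul_le_dyadicWeight m (le_refl n)
        rw [Nat.sub_self, pow_zero, mul_one] at h1
        linarith [dyadicWeight_nonneg m n]
      have h := hf.norm_smoothArea_steklov_sub_le N (hq0 n) (hq1 n) (hlt s t hst) (hlen s t) hw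
        (fun h' => half_pow_mul_sq_le hf.nonneg hf.mono h' (hlen s t))
      rw [show (1 / 2 : ℝ) ^ n / 2 = (1 / 2) ^ (n + 1) by rw [pow_succ]; ring] at h
      exact h
  obtain ⟨α, hα⟩ := exists_limit_of_norm_sub_le hd hstep
  set r : ℕ → ℝ := fun n => ∑' k, d (k + n) with hr_def
  have hr : Tendsto r atTop (𝓝 0) := tendsto_sum_nat_add d
  refine ⟨?_, fun s t => α (s, t), ?_, ⟨?_, ?_⟩, fun n => steklovPath f hf.continuous n, ?_, ?_⟩
  · -- `‖γ t - γ s‖² ≤ C² m(h)² h` with `m(h) → 0`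
    refine vanishingPVar_of_isLittleO two_pos fun ε hε => ?_
    have hlim : Tendsto (fun h => C ^ 2 * m h ^ 2) (𝓝[>] 0) (𝓝 0) := by
      simpa using (hm.pow 2).const_mul (C ^ 2)
    obtain ⟨δ, hδ, H⟩ := mem_nhdsGT_iff_exists_Ioc_subset.1 (hlim.eventually (ge_mem_nhds hε))
    refine ⟨δ, hδ, fun s t hst hd' => ?_⟩
    have hpos : (0 : ℝ) < t - s := sub_pos.2 (hlt s t hst)
    have h1 : C ^ 2 * m ((t : ℝ) - s) ^ 2 ≤ ε := H ⟨hpos, hd'⟩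
    have h2 := hf.increment_le s t (hlt s t hst) (hlen s t)
    rw [Real.rpow_two, increment, hγ, hγ]
    calc ‖f t - f s‖ ^ 2 ≤ (C * (√((t : ℝ) - s) * m (t - s))) ^ 2 := by gcongr
      _ = C ^ 2 * m ((t : ℝ) - s) ^ 2 * √((t : ℝ) - s) ^ 2 := by ring
      _ ≤ ε * ((t : ℝ) - s) := by rw [Real.sq_sqrt hpos.le]; gcongr
  · -- compare with the area of a fixed Steklov mean, which is `O((t - s)²)`
    refine vanishingPVar_of_isLittleO one_pos fun ε hε => ?_
    obtain ⟨n, hn⟩ := (hr.eventually (ge_mem_nhds (half_pos hε))).exists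
    obtain ⟨X, hX⟩ := hspeed n
    refine ⟨ε / 2 / (X ^ 2 + 1), by positivity, fun s t hst hd' => ?_⟩
    have hpos : (0 : ℝ) < t - s := sub_pos.2 (hlt s t hst)
    have h1 := hα n (s, t) hst.le
    have h2 : ‖A n (s, t)‖ ≤ X ^ 2 * ((t : ℝ) - s) * (t - s) :=
      norm_smoothArea_le N (hx n) hX (hlt s t hst).le
    rw [le_div_iff₀ (by positivity)] at hd'
    have h3 : r n * ((t : ℝ) - s) ≤ ε / 2 * (t - s) := by gcongr
    have h4 : X ^ 2 * ((t : ℝ) - s) * (t - s) ≤ ε / 2 * (t - s) := by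
      gcongr
      linarith
    have h5 := norm_add_le (α (s, t) - A n (s, t)) (A n (s, t))
    rw [sub_add_cancel] at h5
    rw [Real.rpow_one]
    simp only at h1
    linarith
  · have hu : TendstoUniformlyOn A α atTop {z : I × I | z.1 ≤ z.2} := by
      rw [Metric.tendstoUniformlyOn_iff]
      intro ε hε
      filter_upwards [hr.eventually (gt_mem_nhds hε)] with n hn z hz
      have hz0 : (0 : ℝ) ≤ z.2 - z.1 := sub_nonneg.2 hz
      have h1 : r n * ((z.2 : ℝ) - z.1) ≤ max (r n) 0 * 1 := by
        gcongr
        · exact le_max_left _ _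
        · exact hlen _ _
      rw [dist_eq_norm]
      refine (hα n z hz).trans_lt (h1.trans_lt ?_)
      rw [mul_one]
      exact max_lt hn hε
    refine hu.continuousOn (Eventually.frequently (Eventually.of_forall fun n => ?_))
    have hcoe : Continuous fun z : I × I => ((z.1 : ℝ), (z.2 : ℝ)) := by fun_prop
    exact ((continuous_smoothArea N (hxc n) (hx' n)).comp hcoe).continuousOn
  · intro t
    have h := hα 0 (t, t) (le_refl t)
    simpa [hA, smoothArea] using h
  · intro n
    obtain ⟨X, hX⟩ := hspeed n
    refine (pVar_le one_pos (K := X) fun s t hst => ?_).trans_lt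
      (ENNReal.rpow_lt_top_of_nonneg (by norm_num) ENNReal.ofReal_ne_top)
    have h1 : ‖x n t - x n s‖ ≤ X * ‖(t : ℝ) - s‖ :=
      Convex.norm_image_sub_le_of_norm_hasDerivWithin_le (s := Set.univ)
        (fun v _ => (hx n v).hasDerivWithinAt) (fun v _ => hX v) convex_univ trivial trivial
    rwa [Real.norm_of_nonneg (sub_nonneg.2 (hlt s t hst).le), ← Real.rpow_one ‖_ - _‖] at h1
  · set K : ℕ → ℝ := fun n => 4 * C ^ 2 * m ((1 / 2) ^ n) ^ 2 with hK
    have hK0 : Tendsto K atTop (𝓝 0) := by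
      have h := hsum.tendsto_atTop_zero.const_mul (4 * C ^ 2)
      rwa [mul_zero] at h
    have hup : Tendsto (fun n => (ENNReal.ofReal (K n) + ENNReal.ofReal (r n)) ^ (1 / 2 : ℝ))
        atTop (𝓝 0) := by
      have h := (((ENNReal.tendsto_ofReal hK0).add (ENNReal.tendsto_ofReal hr)).ennrpow_const
        (1 / 2 : ℝ))
      simpa using h
    refine tendsto_of_tendsto_of_tendsto_of_le_of_le tendsto_const_nhds hup
      (fun _ => zero_le) fun n => ?_
    refine ENNReal.rpow_le_rpow (add_le_add ?_ ?_) (by norm_num)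
    · have h : pVar 2 (increment fun t => γ t - steklovPath f hf.continuous n t) ≤
          ENNReal.ofReal (K n) ^ (1 / 2 : ℝ) := by
        refine pVar_le two_pos fun s t hst => ?_
        rw [Real.rpow_two, increment, hγ, hγ]
        exact hf.norm_sub_steklov_sq_le (hq0 n) (hq1 n) (hlt s t hst) (hlen s t)
      calc _ ≤ (ENNReal.ofReal (K n) ^ (1 / 2 : ℝ)) ^ (2 : ℝ) :=
            ENNReal.rpow_le_rpow h (by norm_num)
        _ = ENNReal.ofReal (K n) := by rw [← ENNReal.rpow_mul]; norm_num
    · have h := pVar_le (E := N.bracketSpace) one_pos (K := r n)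
        (α := fun s t => α (s, t) - area N (steklovPath f hf.continuous n) s t)
        (fun s t hst => by
          have e : area N (steklovPath f hf.continuous n) s t = A n (s, t) :=
            area_eq_smoothArea N (hx n) (hx' n) hst.le
          rw [Real.rpow_one, e]
          exact hα n (s, t) hst.le)
      simpa using h

theorem mem_enhancible_of_modulus (N : TensorNorm V) {γ : C(I, V)} {m : ℝ → ℝ}
    (hm0 : ∀ t ∈ Set.Icc (0 : ℝ) 1, 0 ≤ m t) (hmono : MonotoneOn m (Set.Icc 0 1))
    (hm : Tendsto m (𝓝[>] 0) (𝓝 0))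
    (hint : IntegrableOn (fun t => m t ^ 2 / t) (Set.Ioc 0 1)) {C : ℝ}
    (hC : ∀ s t : I, s < t → ‖γ t - γ s‖ ≤ C * (((t : ℝ) - s) ^ (1 / 2 : ℝ) * m ((t : ℝ) - s))) :
    γ ∈ enhancible N :=
  (hasRootModulus_IccExtend hm0 hmono hC).mem_enhancible N hm
    (summable_sq_half_pow hm0 hmono hint) fun u => (Set.IccExtend_val zero_le_one γ u).symm

end Enhancement

/-! ### Iterated logarithms -/

section IterLog

theorem one_le_iterLog (n : ℕ) {h : ℝ} (h0 : 0 < h) (h1 : h ≤ 1) : 1 ≤ iterLog n h := by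
  induction n with
  | zero => exact (one_le_inv₀ h0).2 h1
  | succ n ih =>
    rw [iterLog]
    linarith [Real.log_nonneg ih]

theorem iterLog_pos (n : ℕ) {h : ℝ} (h0 : 0 < h) (h1 : h ≤ 1) : 0 < iterLog n h :=
  zero_lt_one.trans_le (one_le_iterLog n h0 h1)

theorem iterLog_anti (n : ℕ) {h k : ℝ} (h0 : 0 < h) (hk : h ≤ k) (k1 : k ≤ 1) :
    iterLog n k ≤ iterLog n h := by
  induction n with
  | zero => exact inv_anti₀ h0 hk
  | succ n ih =>
    rw [iterLog, iterLog]
    linarith [Real.log_le_log (iterLog_pos n (h0.trans_le hk) k1) ih]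

theorem tendsto_iterLog (n : ℕ) : Tendsto (iterLog n) (𝓝[>] 0) atTop := by
  induction n with
  | zero => exact tendsto_inv_nhdsGT_zero
  | succ n ih => exact tendsto_atTop_add_const_left _ 1 (Real.tendsto_log_atTop.comp ih)

theorem hasDerivAt_iterLog_succ (n : ℕ) {h : ℝ} (h0 : 0 < h) (h1 : h ≤ 1) :
    HasDerivAt (iterLog (n + 1))
      (-(h⁻¹ * ∏ i ∈ Finset.range n, (iterLog (i + 1) h)⁻¹)) h := by
  induction n with
  | zero =>
    have hd := ((hasDerivAt_inv h0.ne').log (inv_ne_zero h0.ne')).const_add 1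
    refine hd.congr_deriv ?_
    rw [Finset.prod_range_zero]
    field_simp
  | succ n ih =>
    have hd := (ih.log (iterLog_pos (n + 1) h0 h1).ne').const_add 1
    refine hd.congr_deriv ?_
    rw [Finset.prod_range_succ]
    ring

/-- The factor `m` of the modulus `h^{1/2} m(h)` of `logModulus (n + 1) ε`, set to `0` at `0`. -/
noncomputable def logGauge (n : ℕ) (ε h : ℝ) : ℝ :=
  if 0 < h then (∏ i ∈ Finset.range n, iterLog (i + 1) h ^ (-(1 / 2) : ℝ)) *
    iterLog (n + 1) h ^ (-(1 / 2) - ε) else 0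

theorem logModulus_succ (n : ℕ) (ε : ℝ) {h : ℝ} (h0 : 0 < h) :
    logModulus (n + 1) ε h = h ^ (1 / 2 : ℝ) * logGauge n ε h := by
  rw [logModulus, logGauge, if_pos h0, Finset.prod_range_succ', iterLog,
    Real.rpow_neg (inv_nonneg.2 h0.le), Real.inv_rpow h0.le, inv_inv]
  ring

theorem logModulus_pos (n : ℕ) (ε : ℝ) {h : ℝ} (h0 : 0 < h) (h1 : h ≤ 1) :
    0 < logModulus n ε h :=
  mul_pos (Finset.prod_pos fun i _ => Real.rpow_pos_of_pos (iterLog_pos i h0 h1) _)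
    (Real.rpow_pos_of_pos (iterLog_pos n h0 h1) _)

theorem logGauge_nonneg (n : ℕ) (ε : ℝ) {h : ℝ} (h1 : h ≤ 1) : 0 ≤ logGauge n ε h := by
  rw [logGauge]
  split_ifs with h0
  · exact mul_nonneg (Finset.prod_nonneg fun i _ =>
      Real.rpow_nonneg (iterLog_pos _ h0 h1).le _) (Real.rpow_nonneg (iterLog_pos _ h0 h1).le _)
  · exact le_rfl

theorem logGauge_monotoneOn (n : ℕ) {ε : ℝ} (hε : 0 < ε) :
    MonotoneOn (logGauge n ε) (Set.Icc 0 1) := by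
  intro a ha b hb hab
  rcases ha.1.eq_or_lt with rfl | ha0
  · rw [logGauge, if_neg (lt_irrefl _)]
    exact logGauge_nonneg n ε hb.2
  have hb0 := ha0.trans_le hab
  have hL : ∀ i, ∀ c ≤ (0 : ℝ), iterLog i a ^ c ≤ iterLog i b ^ c := fun i c hc =>
    Real.rpow_le_rpow_of_nonpos (iterLog_pos i hb0 hb.2) (iterLog_anti i ha0 hab hb.2) hc
  have hp : ∀ i (c : ℝ), 0 ≤ iterLog i a ^ c := fun i c =>
    Real.rpow_nonneg (iterLog_pos i ha0 ha.2).le c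
  rw [logGauge, logGauge, if_pos ha0, if_pos hb0]
  refine mul_le_mul (Finset.prod_le_prod (fun i _ => hp _ _) fun i _ => hL _ _ (by norm_num))
    (hL _ _ (by linarith)) (hp _ _) (Finset.prod_nonneg fun i _ => ?_)
  exact (hp (i + 1) _).trans (hL _ _ (by norm_num))

theorem logGauge_le (n : ℕ) (ε : ℝ) {h : ℝ} (h0 : 0 < h) (h1 : h ≤ 1) :
    logGauge n ε h ≤ iterLog (n + 1) h ^ (-(1 / 2) - ε) := by
  rw [logGauge, if_pos h0]
  refine mul_le_of_le_one_left (Real.rpow_nonneg (iterLog_pos _ h0 h1).le _)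
    (Finset.prod_le_one (fun i _ => Real.rpow_nonneg (iterLog_pos _ h0 h1).le _) fun i _ => ?_)
  exact Real.rpow_le_one_of_one_le_of_nonpos (one_le_iterLog _ h0 h1) (by norm_num)

theorem tendsto_iterLog_rpow (n : ℕ) {c : ℝ} (hc : c < 0) :
    Tendsto (fun h => iterLog n h ^ c) (𝓝[>] 0) (𝓝 0) := by
  have := (tendsto_rpow_neg_atTop (neg_pos.2 hc)).comp (tendsto_iterLog n)
  rwa [neg_neg] at this

theorem tendsto_logGauge (n : ℕ) {ε : ℝ} (hε : 0 < ε) :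
    Tendsto (logGauge n ε) (𝓝[>] 0) (𝓝 0) := by
  refine tendsto_of_tendsto_of_tendsto_of_le_of_le' tendsto_const_nhds
    (tendsto_iterLog_rpow (n + 1) (c := -(1 / 2) - ε) (by linarith)) ?_ ?_
  · filter_upwards [Ioc_mem_nhdsGT zero_lt_one] with h hh using logGauge_nonneg n ε hh.2
  · filter_upwards [Ioc_mem_nhdsGT zero_lt_one] with h hh using logGauge_le n ε hh.1 hh.2

theorem logGauge_sq_div (n : ℕ) (ε : ℝ) {h : ℝ} (h0 : 0 < h) (h1 : h ≤ 1) :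
    logGauge n ε h ^ 2 / h = (h⁻¹ * ∏ i ∈ Finset.range n, (iterLog (i + 1) h)⁻¹) *
      iterLog (n + 1) h ^ (-(2 * ε) - 1) := by
  have hsq : ∀ i (c : ℝ), (iterLog i h ^ c) ^ 2 = iterLog i h ^ (2 * c) := fun i c => by
    rw [← Real.rpow_natCast, ← Real.rpow_mul (iterLog_pos i h0 h1).le, mul_comm]
    norm_num
  have hprod : ∏ i ∈ Finset.range n, (iterLog (i + 1) h ^ (-(1 / 2) : ℝ)) ^ 2 =
      ∏ i ∈ Finset.range n, (iterLog (i + 1) h)⁻¹ := Finset.prod_congr rfl fun i _ => by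
    rw [hsq, ← Real.rpow_neg_one]
    norm_num
  rw [logGauge, if_pos h0, mul_pow, ← Finset.prod_pow, hprod, hsq,
    show 2 * (-(1 / 2) - ε) = -(2 * ε) - 1 by ring]
  ring

/-- `Lₙ₊₁^{-2ε} / (2ε)` is a primitive of `m² / t`, continuous up to `0`. -/
theorem integrableOn_logGauge_sq_div (n : ℕ) {ε : ℝ} (hε : 0 < ε) :
    IntegrableOn (fun t => logGauge n ε t ^ 2 / t) (Set.Ioc 0 1) := by
  set g : ℝ → ℝ := fun h => if 0 < h then iterLog (n + 1) h ^ (-(2 * ε)) / (2 * ε) else 0 with hg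
  have hd : ∀ h, 0 < h → h ≤ 1 → HasDerivAt g (logGauge n ε h ^ 2 / h) h := by
    intro h h0 h1
    have hev : g =ᶠ[𝓝 h] fun h => iterLog (n + 1) h ^ (-(2 * ε)) / (2 * ε) := by
      filter_upwards [lt_mem_nhds h0] with k hk
      rw [hg]
      exact if_pos hk
    refine HasDerivAt.congr_of_eventuallyEq ?_ hev
    have := ((hasDerivAt_iterLog_succ n h0 h1).rpow_const (p := -(2 * ε))
      (Or.inl (iterLog_pos (n + 1) h0 h1).ne')).div_const (2 * ε)
    refine this.congr_deriv ?_
    rw [logGauge_sq_div n ε h0 h1]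
    field_simp
  refine intervalIntegral.integrableOn_deriv_of_nonneg (g := g) ?_ (fun h hh => hd h hh.1 hh.2.le)
    (fun h hh => div_nonneg (sq_nonneg _) hh.1.le)
  intro h hh
  rcases hh.1.eq_or_lt with rfl | h0
  · have hlim : ContinuousWithinAt g (Set.Ioi 0) 0 := by
      have hg0 : g 0 = 0 := if_neg (lt_irrefl _)
      rw [ContinuousWithinAt, hg0]
      have h1 := (tendsto_iterLog_rpow (n + 1) (c := -(2 * ε)) (by linarith)).div_const (2 * ε)
      rw [zero_div] at h1
      refine h1.congr' ?_
      filter_upwards [self_mem_nhdsWithin] with k hk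
      exact (if_pos hk).symm
    exact (continuousWithinAt_Ioi_iff_Ici.1 hlim).mono fun k hk => hk.1
  · exact (hd h h0 hh.2).continuousAt.continuousWithinAt

theorem one_add_log_rpow_le {a b x : ℝ} (ha : 0 < a) (hb : 0 < b) (hx : 1 ≤ x) :
    (1 + Real.log x) ^ a ≤ (1 + a / b) ^ a * x ^ b := by
  have hx0 : 0 < x := zero_lt_one.trans_le hx
  have hc : 0 < b / a := div_pos hb ha
  have h1 := Real.log_le_rpow_div hx0.le hc
  have h2 := Real.one_le_rpow hx hc.le
  have h3 : 1 + Real.log x ≤ (1 + a / b) * x ^ (b / a) := by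
    have : x ^ (b / a) / (b / a) = a / b * x ^ (b / a) := by field_simp
    linarith
  calc (1 + Real.log x) ^ a ≤ ((1 + a / b) * x ^ (b / a)) ^ a :=
        Real.rpow_le_rpow (by linarith [Real.log_nonneg hx]) h3 ha.le
    _ = (1 + a / b) ^ a * x ^ b := by
        rw [Real.mul_rpow (by positivity) (by positivity), ← Real.rpow_mul hx0.le,
          div_mul_cancel₀ _ ha.ne']

theorem exists_logModulus_le (n : ℕ) {ε ε' : ℝ} (hε : 0 < ε) (hε' : 0 < ε') :
    ∃ K : ℝ, 0 ≤ K ∧ ∀ h, 0 < h → h ≤ 1 → logModulus n ε h ≤ K * logModulus (n + 1) ε' h := by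
  set a := 1 / 2 + ε' with ha_def
  have ha : 0 < a := by positivity
  refine ⟨(1 + a / ε) ^ a, by positivity, fun h h0 h1 => ?_⟩
  set x := iterLog n h with hx
  have hx1 : 1 ≤ x := one_le_iterLog n h0 h1
  have hx0 : 0 < x := iterLog_pos n h0 h1
  have hy0 : 0 < 1 + Real.log x := iterLog_pos (n + 1) h0 h1
  have hP : 0 ≤ ∏ i ∈ Finset.range n, iterLog i h ^ (-(1 / 2) : ℝ) :=
    Finset.prod_nonneg fun i _ => Real.rpow_nonneg (iterLog_pos i h0 h1).le _
  have key : x ^ (-(1 / 2) - ε) ≤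
      (1 + a / ε) ^ a * (x ^ (-(1 / 2) : ℝ) * (1 + Real.log x) ^ (-(1 / 2) - ε')) := by
    have h2 := one_add_log_rpow_le ha hε hx1
    have e1 : (1 + Real.log x) ^ (-(1 / 2) - ε') = ((1 + Real.log x) ^ a)⁻¹ := by
      rw [← Real.rpow_neg hy0.le, ha_def]
      congr 1
      ring
    have e2 : x ^ (-(1 / 2) - ε) = x ^ (-(1 / 2) : ℝ) * (x ^ ε)⁻¹ := by
      rw [← Real.rpow_neg hx0.le, ← Real.rpow_add hx0, sub_eq_add_neg]
    have hxε : 0 < x ^ ε := Real.rpow_pos_of_pos hx0 _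
    have hya : 0 < (1 + Real.log x) ^ a := Real.rpow_pos_of_pos hy0 _
    have hxh : 0 ≤ x ^ (-(1 / 2) : ℝ) := Real.rpow_nonneg hx0.le _
    rw [e1, e2, mul_left_comm]
    refine mul_le_mul_of_nonneg_left ?_ hxh
    rw [← div_eq_mul_inv, le_div_iff₀ hya, inv_mul_le_iff₀ hxε]
    linarith
  rw [logModulus, logModulus, Finset.prod_range_succ]
  calc _ ≤ (∏ i ∈ Finset.range n, iterLog i h ^ (-(1 / 2) : ℝ)) *
        ((1 + a / ε) ^ a * (x ^ (-(1 / 2) : ℝ) * (1 + Real.log x) ^ (-(1 / 2) - ε'))) := by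
        gcongr
    _ = _ := by rw [iterLog]; ring

end IterLog

/-! ### The spaces of paths with a logarithmic modulus -/

section LogModulus

variable {V : Type*} [NormedAddCommGroup V] [NormedSpace ℝ V]

theorem modulusSpace_logModulus_le (n : ℕ) {ε ε' : ℝ} (hε : 0 < ε) (hε' : 0 < ε') :
    modulusSpace V (logModulus n ε) ≤ modulusSpace V (logModulus (n + 1) ε') := by
  obtain ⟨K, hK, H⟩ := exists_logModulus_le n hε hε'
  rintro γ ⟨C, hC⟩
  refine ⟨|C| * K, fun s t hst => ?_⟩
  have h0 : (0 : ℝ) < t - s := sub_pos.2 hst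
  have h1 : (t : ℝ) - s ≤ 1 := by linarith [t.2.2, s.2.1]
  have h2 := logModulus_pos n ε h0 h1
  calc _ ≤ C * logModulus n ε (t - s) := hC s t hst
    _ ≤ |C| * (K * logModulus (n + 1) ε' (t - s)) := by
        have := H _ h0 h1
        have := le_abs_self C
        gcongr
    _ = _ := by ring

theorem modulusSpace_logModulus_subset [CompleteSpace V] (N : TensorNorm V) (n : ℕ) {ε : ℝ}
    (hε : 0 < ε) : (modulusSpace V (logModulus n ε) : Set C(I, V)) ⊆ enhancible N := by
  intro γ hγ
  obtain ⟨C, hC⟩ := modulusSpace_logModulus_le n hε hε hγ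
  refine mem_enhancible_of_modulus N (fun t ht => logGauge_nonneg n ε ht.2)
    (logGauge_monotoneOn n hε) (tendsto_logGauge n hε) (integrableOn_logGauge_sq_div n hε)
    (C := C) fun s t hst => ?_
  rw [← logModulus_succ n ε (sub_pos.2 hst)]
  exact hC s t hst

end LogModulus

end AreaOperator

theorem mainTheorem3 {V : Type*} [NormedAddCommGroup V] [NormedSpace ℝ V] [CompleteSpace V]
    (N : AreaOperator.TensorNorm V) :
    (∀ (γ : C(unitInterval, V)) (m : ℝ → ℝ),
      (∀ t ∈ Set.Icc (0 : ℝ) 1, 0 ≤ m t) →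
      MonotoneOn m (Set.Icc 0 1) →
      Filter.Tendsto m (nhdsWithin 0 (Set.Ioi 0)) (nhds 0) →
      m 1 ≤ 1 →
      MeasureTheory.IntegrableOn (fun t => m t ^ 2 / t) (Set.Ioc 0 1) →
      (∃ C : ℝ, ∀ s t : unitInterval, s < t →
        ‖γ t - γ s‖ ≤ C * (((t : ℝ) - s) ^ (1 / 2 : ℝ) * m ((t : ℝ) - s))) →
      γ ∈ AreaOperator.enhancible N) ∧
    (∀ ε : ℝ, 0 < ε →
      (∀ n : ℕ, (AreaOperator.modulusSpace V (AreaOperator.logModulus n ε) :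
        Set C(unitInterval, V)) ⊆ AreaOperator.enhancible N) ∧
      (∀ ε' : ℝ, 0 < ε' → ∀ n : ℕ,
        AreaOperator.modulusSpace V (AreaOperator.logModulus n ε) ≤
          AreaOperator.modulusSpace V (AreaOperator.logModulus (n + 1) ε')) ∧
      ∃ W : Submodule ℝ C(unitInterval, V),
        (W : Set C(unitInterval, V)) =
          (⋃ n : ℕ, (AreaOperator.modulusSpace V (AreaOperator.logModulus n ε) :
            Set C(unitInterval, V))) ∧
        (W : Set C(unitInterval, V)) ⊆ AreaOperator.enhancible N) := by
  refine ⟨fun γ m hm0 hmono hm _ hint ⟨C, hC⟩ =>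
    AreaOperator.mem_enhancible_of_modulus N hm0 hmono hm hint hC, fun ε hε =>
    ⟨fun n => AreaOperator.modulusSpace_logModulus_subset N n hε,
      fun ε' hε' n => AreaOperator.modulusSpace_logModulus_le n hε hε',
      ⨆ n, AreaOperator.modulusSpace V (AreaOperator.logModulus n ε), ?_⟩⟩
  have hmono : Monotone fun n => AreaOperator.modulusSpace V (AreaOperator.logModulus n ε) :=
    monotone_nat_of_le_succ fun n => AreaOperator.modulusSpace_logModulus_le n hε hε
  have hcoe := Submodule.coe_iSup_of_directed _ hmono.directed_le
  exact ⟨hcoe, hcoe ▸ Set.iUnion_subset fun n =>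
    AreaOperator.modulusSpace_logModulus_subset N n hε⟩
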